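/- Let $SL_2=SL_2(\mathbb C)$ act on $(\mathbb C^2)^{\oplus 6}=\mathrm{Mat}_{2\times 6}(\mathbb C)$ by left multiplication, and let $X=(x_{kj})$ be the generic $2\times 6$ matrix. For $d\ge 0$ let $V_d=\mathbb C[x,y]_d$ be the irreducible representation of dimension $d+1$. For an $SL_2$-stable closed subscheme $Y\subset \mathrm{Mat}_{2\times 6}$ let $\mathrm{Hilb}^{SL_2}(Y)$ denote the invariant Hilbert scheme with Hilbert function $h(d)=d+1$: its points with values in a commutative $\mathbb C$-algebra $A$ are the $SL_2$-stable ideals $I\subset A[x_{11},\dots,x_{26}]$ defining closed subschemes of $Y\times\operatorname{Spec}A$ such that every module of covariants $\mathrm{Hom}^{SL_2}(V_d,A[x_{kj}]/I)$ is a locally free $A$-module of rank $d+1$. The group $\mathbb C^*$ acts on $\mathrm{Mat}_{2\times 6}$ by scalar multiplication and hence on these Hilbert schemes (when $Y$ is a cone). Let $J=\begin{pmatrix}0&1\\-1&0\end{pmatrix}$, $Q=\begin{pmatrix}0&I_3\\I_3&0\end{pmatrix}$, $\mu(M)=MQM^tJ$, and let $\mu^{-1}(0)$ be the scheme-theoretic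 zero fibre. Let $\perp$ and "isotropic" refer to the symmetric bilinear form $\langle v,w\rangle=v^tQw$. For a commutative $\mathbb C$-algebra $A$ let $Gr(2,\mathbb C^6)(A)$ be the set of submodules $U\subset A^6$ such that $A^6/U$ is locally free of rank $4$, and let $OG(2,\mathbb C^6)(A)$ be the subset of those $U$ on which the form vanishes identically. For $U\in Gr(2,\mathbb C^6)(A)$ let $I_U\subset A[x_{kj}]$ be the ideal generated by the two entries of $Xv$ for all $v\in U^\perp$ and by all $2\times 2$ minors $\Lambda^{ij}$ of $X$ (columns $i,j$). 1. For every commutative $\mathbb C$-algebra $A$, the map $U\mapsto I_U$ is a bijection from $Gr(2,\mathbb C^6)(A)$ onto the set of $\mathbb C^*$-fixed $A$-points of $\mathrm{Hilb}^{SL_2}((\mathbb C^2)^{\oplus 6})$, and it restricts to a bijection from $OG(2,\mathbb C^6)(A)$ onto the set of $\mathbb C^*$-fixed $A$-points of $\mathrm{Hilb}^{SL_2}(\mu^{-1}(0))$. These bijections are compatible with base change along homomorphisms $A\to B$ of $\mathbb C$-algebras. Hence the $\mathbb C^*$-fixed locus of $\mathrm{Hilb}^{SL_2}((\mathbb C^2)^{\oplus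 6})$ is isomorphic to $Gr(2,\mathbb C^6)$, and that of $\mathrm{Hilb}^{SL_2}(\mu^{-1}(0))$ to $OG(2,\mathbb C^6)$. 2. In particular, for $A=\mathbb C$, the map $U\mapsto I_U$ is a bijection from the set of $2$-dimensional subspaces of $\mathbb C^6$ (respectively, of isotropic ones) onto the set of $\mathbb C^*$-fixed closed points of $\mathrm{Hilb}^{SL_2}((\mathbb C^2)^{\oplus 6})$ (respectively, of $\mathrm{Hilb}^{SL_2}(\mu^{-1}(0))$). 3. The $\mathbb C^*$-fixed closed points of $\mathrm{Hilb}^{SL_2}((\mathbb C^2)^{\oplus 6})$ are exactly the ideals $I\subset\mathbb C[x_{11},\dots,x_{26}]$ for which there are a $4$-dimensional subspace $V\subset\mathbb C^6$ and indices $i,j$ with $V+\langle e_i,e_j\rangle=\mathbb C^6$ such that $I$ is generated by the two entries of $Xv$ for all $v\in V$ together with the single minor $\Lambda^{ij}$. Those lying in $\mathrm{Hilb}^{SL_2}(\mu^{-1}(0))$ are exactly the ideals of this form for which, in addition, $V^\perp$ is isotropic. -/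

import Mathlib

open scoped Matrix MatrixGroups

universe u

namespace SlTwoHilb

/-! ### The representation `(ℂ²)^{⊕6} = Mat_{2×6}` and the actions of `SL₂` and `ℂ*` -/

/-- The coordinate ring `A[x₁₁, …, x₂₆]` of the space of `2 × 6` matrices over a ring `A`;
the variable indexed by `(k, j)` is the entry in row `k` and column `j`. -/
abbrev CoordRing (A : Type u) [CommRing A] : Type u := MvPolynomial (Fin 2 × Fin 6) A

/-- The generic `2 × 6` matrix `X = (x_{kj})`. -/
noncomputable abbrev genMat (A : Type u) [CommRing A] :
    Matrix (Fin 2) (Fin 6) (CoordRing A) :=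
  Matrix.mvPolynomialX (Fin 2) (Fin 6) A

/-- The action of `SL₂(ℂ)` on functions induced by left multiplication on `2 × 6` matrices:
`(g • f)(M) = f(g⁻¹ M)`. -/
noncomputable def slAct (A : Type u) [CommRing A] [Algebra ℂ A] :
    SL(2, ℂ) →* (CoordRing A →ₐ[A] CoordRing A) where
  toFun g := MvPolynomial.aeval fun kj =>
    (((g⁻¹ : SL(2, ℂ)) : Matrix (Fin 2) (Fin 2) ℂ).map (algebraMap ℂ (CoordRing A)) *
      genMat A) kj.1 kj.2
  map_one' := by
    refine MvPolynomial.algHom_ext fun kj => ?_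
    rw [MvPolynomial.aeval_X, inv_one, Matrix.SpecialLinearGroup.coe_one,
      Matrix.map_one _ (map_zero _) (map_one _), Matrix.one_mul]
    rfl
  map_mul' g h := by
    refine MvPolynomial.algHom_ext fun kj => ?_
    obtain ⟨k, j⟩ := kj
    simp only [mul_inv_rev, Matrix.SpecialLinearGroup.coe_mul, Matrix.map_mul, Matrix.mul_assoc,
      AlgHom.mul_apply, MvPolynomial.aeval_X]
    rw [Matrix.mul_apply, Matrix.mul_apply, map_sum]
    refine Finset.sum_congr rfl fun l _ => ?_
    simp only [Matrix.map_apply, map_mul, Matrix.mvPolynomialX_apply, MvPolynomial.aeval_X,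
      MvPolynomial.algebraMap_eq, MvPolynomial.algebraMap_apply, MvPolynomial.algHom_C]

/-- The action of `ℂ*` on functions induced by scalar multiplication on `2 × 6` matrices:
`(t • f)(M) = f(t⁻¹ M)`. -/
noncomputable def scaleAct (A : Type u) [CommRing A] [Algebra ℂ A] :
    ℂˣ →* (CoordRing A →ₐ[A] CoordRing A) where
  toFun t := MvPolynomial.aeval fun kj =>
    algebraMap ℂ (CoordRing A) ((t⁻¹ : ℂˣ) : ℂ) * MvPolynomial.X kj
  map_one' := by
    ext kj
    simp
  map_mul' s t := by
    refine MvPolynomial.algHom_ext fun kj => ?_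
    simp only [mul_inv_rev, Units.val_mul, AlgHom.mul_apply, MvPolynomial.aeval_X, map_mul,
      MvPolynomial.algebraMap_eq, MvPolynomial.algebraMap_apply, MvPolynomial.algHom_C]
    ring

/-! ### The irreducible representations of `SL₂` -/

/-- The action of `SL₂(ℂ)` on `ℂ[x, y]`: `(g • p)(w) = p(g⁻¹ w)`. -/
noncomputable def binAct :
    SL(2, ℂ) →* (MvPolynomial (Fin 2) ℂ →ₐ[ℂ] MvPolynomial (Fin 2) ℂ) where
  toFun g := MvPolynomial.aeval
    ((((g⁻¹ : SL(2, ℂ)) : Matrix (Fin 2) (Fin 2) ℂ).map MvPolynomial.C) *ᵥ MvPolynomial.X)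
  map_one' := by
    refine MvPolynomial.algHom_ext fun k => ?_
    rw [MvPolynomial.aeval_X, inv_one, Matrix.SpecialLinearGroup.coe_one,
      Matrix.map_one _ (map_zero _) (map_one _), Matrix.one_mulVec]
    rfl
  map_mul' g h := by
    refine MvPolynomial.algHom_ext fun k => ?_
    simp only [mul_inv_rev, Matrix.SpecialLinearGroup.coe_mul, Matrix.map_mul,
      ← Matrix.mulVec_mulVec, AlgHom.mul_apply, MvPolynomial.aeval_X]
    rw [Matrix.mulVec, Matrix.mulVec, dotProduct, dotProduct, map_sum]
    refine Finset.sum_congr rfl fun l _ => ?_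
    simp only [Matrix.map_apply, map_mul, MvPolynomial.aeval_X, MvPolynomial.algHom_C,
      MvPolynomial.algebraMap_eq]

/-- The space `V_d = ℂ[x, y]_d` of binary forms of degree `d`. -/
abbrev BinForm (d : ℕ) : Type := MvPolynomial.homogeneousSubmodule (Fin 2) ℂ d

lemma binAct_mem (d : ℕ) (g : SL(2, ℂ)) (p : MvPolynomial (Fin 2) ℂ)
    (hp : p ∈ MvPolynomial.homogeneousSubmodule (Fin 2) ℂ d) :
    (binAct g).toLinearMap p ∈ MvPolynomial.homogeneousSubmodule (Fin 2) ℂ d := by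
  rw [MvPolynomial.mem_homogeneousSubmodule] at hp ⊢
  rw [← one_mul d]
  refine hp.aeval _ fun k => ?_
  rw [Matrix.mulVec, dotProduct]
  refine MvPolynomial.IsHomogeneous.sum _ _ _ fun l _ => ?_
  exact zero_add 1 ▸ (MvPolynomial.isHomogeneous_C (Fin 2)
    (((g⁻¹ : SL(2, ℂ)) : Matrix (Fin 2) (Fin 2) ℂ) k l)).mul (MvPolynomial.isHomogeneous_X ℂ l)

/-- The irreducible representation `V_d = ℂ[x, y]_d` of `SL₂(ℂ)`. -/
noncomputable def binRep (d : ℕ) : Representation ℂ SL(2, ℂ) (BinForm d) where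
  toFun g := (binAct g).toLinearMap.restrict (binAct_mem d g)
  map_one' := by
    ext p
    simp [LinearMap.restrict_apply]
  map_mul' g h := by
    ext p
    simp [LinearMap.restrict_apply]

/-! ### The invariant Hilbert functor

A closed subscheme of `Mat_{2×6} × Spec A` is an ideal of `CoordRing A`. -/

/-- `I` is stable under the action of `SL₂`. -/
def SlStable {A : Type u} [CommRing A] [Algebra ℂ A] (I : Ideal (CoordRing A)) : Prop :=
  ∀ g : SL(2, ℂ), I ≤ I.comap (slAct A g)

/-- The action of `SL₂(ℂ)` on the coordinate ring `A[X] / I` of an invariant closed subscheme. -/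
noncomputable def slActQuot {A : Type u} [CommRing A] [Algebra ℂ A] (I : Ideal (CoordRing A))
    (hI : SlStable I) (g : SL(2, ℂ)) : (CoordRing A ⧸ I) →ₐ[A] (CoordRing A ⧸ I) :=
  Ideal.quotientMapₐ I (slAct A g) (hI g)

/-- The module of covariants `F_d = Hom^{SL₂}(V_d, A[X] / I)`. -/
noncomputable def covariants {A : Type u} [CommRing A] [Algebra ℂ A] (I : Ideal (CoordRing A))
    (hI : SlStable I) (d : ℕ) : Submodule A (BinForm d →ₗ[ℂ] (CoordRing A ⧸ I)) where
  carrier := {φ | ∀ (g : SL(2, ℂ)) (p : BinForm d), φ (binRep d g p) = slActQuot I hI g (φ p)}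
  add_mem' := by
    intro φ ψ hφ hψ g p
    simp [hφ g p, hψ g p]
  zero_mem' := by
    intro g p
    simp
  smul_mem' := by
    intro a φ hφ g p
    simp [hφ g p]

/-- `M` is locally free of rank `n` over `A`, i.e. finitely generated projective of constant
rank `n`. -/
def IsLocallyFreeOfRank (A : Type u) [CommRing A] (M : Type u) [AddCommGroup M] [Module A M]
    (n : ℕ) : Prop :=
  Module.Finite A M ∧ Module.Projective A M ∧ ∀ p, Module.rankAtStalk (R := A) M p = n

/-- The `A`-valued points of the invariant Hilbert scheme `Hilb^{SL₂}_h(X)`, where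
`X ⊆ Mat_{2×6}` is the closed subscheme cut out by the ideal `K`: the `SL₂`-invariant closed
subschemes of `X × Spec A` all of whose modules of covariants `F_d` are locally free of rank
`h d`. (These families are then automatically flat over `A`.) -/
def invHilb (h : ℕ → ℕ) (K : Ideal (CoordRing ℂ)) (A : Type u) [CommRing A] [Algebra ℂ A] :
    Set (Ideal (CoordRing A)) :=
  {I | K.map (MvPolynomial.map (algebraMap ℂ A)) ≤ I ∧
    ∃ hI : SlStable I, ∀ d : ℕ, IsLocallyFreeOfRank A (covariants I hI d) (h d)}

/-- The `SL₂`-Hilbert scheme: the Hilbert function is `h(d) = dim V_d = d + 1`. -/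
def slHilb (K : Ideal (CoordRing ℂ)) (A : Type u) [CommRing A] [Algebra ℂ A] :
    Set (Ideal (CoordRing A)) :=
  invHilb (fun d => d + 1) K A

/-- The `A`-valued points of the `SL₂`-Hilbert scheme which are fixed by the action
`Z ↦ tZ` of `ℂ*`. -/
def slHilbFixed (K : Ideal (CoordRing ℂ)) (A : Type u) [CommRing A] [Algebra ℂ A] :
    Set (Ideal (CoordRing A)) :=
  {I | I ∈ slHilb K A ∧ ∀ t : ℂˣ, I.map (scaleAct A t) = I}

/-! ### The quadratic form and the zero fibre of the moment map -/

/-- The symmetric matrix `Q = (0 I₃; I₃ 0)`. -/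
def matQ (A : Type u) [CommRing A] : Matrix (Fin 6) (Fin 6) A :=
  !![0, 0, 0, 1, 0, 0;
     0, 0, 0, 0, 1, 0;
     0, 0, 0, 0, 0, 1;
     1, 0, 0, 0, 0, 0;
     0, 1, 0, 0, 0, 0;
     0, 0, 1, 0, 0, 0]

/-- The symplectic matrix `J = (0 1; -1 0)`. -/
def matJ (A : Type u) [CommRing A] : Matrix (Fin 2) (Fin 2) A :=
  !![0, 1; -1, 0]

/-- The ideal of the scheme-theoretic zero fibre of the moment map `μ(M) = M Q Mᵗ J`. -/
noncomputable def muIdeal : Ideal (CoordRing ℂ) :=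
  Ideal.span {f | ∃ k l : Fin 2,
    f = (genMat ℂ * matQ (CoordRing ℂ) * (genMat ℂ)ᵀ * matJ (CoordRing ℂ)) k l}

/-- The bilinear form `⟨v, w⟩ = vᵗ Q w` on `A⁶`. -/
noncomputable def formQ (A : Type u) [CommRing A] : LinearMap.BilinForm A (Fin 6 → A) :=
  Matrix.toBilin' (matQ A)

/-! ### The Grassmannian of planes and the associated ideals -/

/-- The `A`-valued points of the Grassmannian `Gr(2, ℂ⁶)`: the submodules of `A⁶` which are
direct summands of rank `2`, i.e. those with locally free quotient of rank `4`. -/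
def planes (A : Type u) [CommRing A] : Set (Submodule A (Fin 6 → A)) :=
  {U | IsLocallyFreeOfRank A ((Fin 6 → A) ⧸ U) 4}

/-- `U` is isotropic for the form `Q`. -/
def IsIsotropic {A : Type u} [CommRing A] (U : Submodule A (Fin 6 → A)) : Prop :=
  ∀ u ∈ U, ∀ v ∈ U, formQ A u v = 0

/-- The `A`-valued points of the Grassmannian of isotropic planes in `ℂ⁶`. -/
def isoPlanes (A : Type u) [CommRing A] : Set (Submodule A (Fin 6 → A)) :=
  {U | U ∈ planes A ∧ IsIsotropic U}

/-- The ideal generated by the linear forms `M ↦ (M v)_k` with `v ∈ V` and `k = 1, 2`; it is the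
ideal of the matrices `M` that vanish on `V`. -/
noncomputable def linIdeal {A : Type u} [CommRing A] (V : Submodule A (Fin 6 → A)) :
    Ideal (CoordRing A) :=
  Ideal.span {f | ∃ v ∈ V, ∃ k : Fin 2, f = (genMat A *ᵥ fun j => MvPolynomial.C (v j)) k}

/-- The `2 × 2` minor `Λ^{ij}` of the columns `i` and `j` of the generic matrix. -/
noncomputable def minor (A : Type u) [CommRing A] (i j : Fin 6) : CoordRing A :=
  ((genMat A).submatrix id ![i, j]).det

/-- The ideal attached to a plane `U`: it is generated by the linear forms belonging to the
orthogonal complement `V = U^⊥` with respect to `Q` and by all `2 × 2` minors. -/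
noncomputable def planeIdeal {A : Type u} [CommRing A] (U : Submodule A (Fin 6 → A)) :
    Ideal (CoordRing A) :=
  linIdeal ((formQ A).orthogonal U) ⊔ Ideal.span {f | ∃ i j : Fin 6, f = minor A i j}

/-- The base change to `B` of a submodule of `A⁶`. -/
def baseChange {A B : Type u} [CommRing A] [CommRing B] (f : A →+* B)
    (U : Submodule A (Fin 6 → A)) : Submodule B (Fin 6 → B) :=
  Submodule.span B {w | ∃ v ∈ U, w = fun j => f (v j)}

end SlTwoHilb

/-!
If `I` is a point of the `SL₂`-Hilbert scheme, then `F₀` has rank `1`, so the invariants of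
`A[X] / I` are the scalars. The minors are invariant, and scaling by `2` multiplies them by `4`
but fixes the scalars; hence a `ℂ*`-fixed `I` contains them all.

The substitution `x_{kj} ↦ w_k z_j` embeds `A[X] / (minors)` into `A[z][w]`, where `SL₂` acts on
`w` only. A fixed `I` is therefore determined by the homogeneous ideal `N ⊆ A[z]` of the functions
of the first row of `X` that it contains, and the covariants of type `V_d` of `A[X] / I` are the
part of degree `d` of `A[z] / N`. For `d = 1` this says that `V = N₁` has a quotient `A⁶ / V` which
is locally free of rank `2`. For all `d`, the map `Sym^d (A⁶ / V) → (A[z] / N)_d` is then a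
surjection between locally free modules of the same rank `d + 1`, hence an isomorphism, so that
`N` is generated by `V`, and `I = I_U` for `U = V^⊥`.

Modulo `I_U` the rows of `X` are combinations of elements of `Q U`, so that the entries of `X Q Xᵗ`
lie in `I_U` exactly when `U` is isotropic.
-/

universe v

namespace SlTwoHilb

open MvPolynomial

/-! ### Linear forms and linear substitutions -/

lemma coeff_mem_of_forall_eval_mem {K σ B : Type*} [Field K] [Infinite K] [CommRing B]
    [Algebra K B] {W : Submodule K B} {p : MvPolynomial σ K} (hp : p ≠ 0) {F : MvPolynomial σ B}
    (h : ∀ a : σ → K, eval a p ≠ 0 → eval (fun i => algebraMap K B (a i)) F ∈ W) (m : σ →₀ ℕ) :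
    coeff m F ∈ W := by
  classical
  by_contra hm
  obtain ⟨l, hl, hW⟩ := Submodule.exists_le_ker_of_notMem hm
  let g : MvPolynomial σ K := ∑ n ∈ F.support, monomial n (l (coeff n F))
  have eval_g (a : σ → K) : eval a g = l (eval (fun i => algebraMap K B (a i)) F) := by
    rw [map_sum, eval_eq, map_sum]
    refine Finset.sum_congr rfl fun n _ => ?_
    rw [eval_monomial, mul_comm, ← smul_eq_mul, ← map_smul, Algebra.smul_def, mul_comm]
    simp only [Finsupp.prod, map_prod, map_pow]
  have coeff_g : coeff m g = l (coeff m F) := by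
    simp only [g, coeff_sum, coeff_monomial, Finset.sum_ite_eq', ite_eq_left_iff,
      notMem_support_iff]
    intro hm0
    rw [hm0, map_zero]
  have mul_g : p * g = 0 := MvPolynomial.funext fun a => by
    by_cases ha : eval a p = 0
    · rw [map_mul, ha, zero_mul, map_zero]
    · rw [map_mul, eval_g, LinearMap.mem_ker.1 (hW (h a ha)), mul_zero, map_zero]
  rw [← coeff_g, (mul_eq_zero.1 mul_g).resolve_left hp] at hl
  exact hl (coeff_zero m)

section LinearForms

variable {ι κ R S : Type*} [Fintype ι] [CommRing R] [CommRing S]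

/-- The linear form `∑ j, v j • X j` with coefficient vector `v`. -/
noncomputable def linForm : (ι → R) →ₗ[R] MvPolynomial ι R :=
  Fintype.linearCombination R X

lemma linForm_apply (v : ι → R) : linForm v = ∑ j, v j • X j :=
  rfl

lemma isHomogeneous_linForm (v : ι → R) : (linForm v).IsHomogeneous 1 :=
  IsHomogeneous.sum _ _ _ fun j _ => by
    simpa only [smul_eq_C_mul] using isHomogeneous_C_mul_X (v j) j

@[simp]
lemma linForm_single [DecidableEq ι] (j : ι) : linForm (Pi.single j (1 : R)) = X j := by
  simp [linForm]

@[simp]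
lemma map_linForm (f : R →+* S) (v : ι → R) :
    MvPolynomial.map f (linForm v) = linForm (fun j => f (v j)) := by
  simp [linForm_apply, smul_eq_C_mul]

lemma aeval_linForm [Algebra R S] (s : ι → S) (v : ι → R) :
    aeval s (linForm v) = ∑ j, v j • s j := by
  simp [linForm_apply]

/-- The substitution of the linear form given by the `k`-th row of `M` for the variable `X k`. -/
noncomputable def linSubst (M : Matrix κ ι R) : MvPolynomial κ R →ₐ[R] MvPolynomial ι R :=
  aeval fun k => linForm (M k)

@[simp]
lemma linSubst_X (M : Matrix κ ι R) (k : κ) : linSubst M (X k) = linForm (M k) :=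
  aeval_X _ _

lemma linSubst_linForm [Fintype κ] (M : Matrix κ ι R) (v : κ → R) :
    linSubst M (linForm v) = linForm (v ᵥ* M) := by
  simp only [linSubst, aeval_linForm, Matrix.vecMul_eq_sum, map_sum, map_smul]

lemma linSubst_linSubst {τ : Type*} [Fintype κ] (M : Matrix τ κ R) (N : Matrix κ ι R)
    (p : MvPolynomial τ R) : linSubst N (linSubst M p) = linSubst (M * N) p := by
  refine DFunLike.congr_fun (?_ : (linSubst N).comp (linSubst M) = linSubst (M * N)) p
  refine algHom_ext fun k => ?_
  rw [AlgHom.comp_apply, linSubst_X, linSubst_linForm, linSubst_X, Matrix.mul_apply_eq_vecMul]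

@[simp]
lemma linSubst_one [DecidableEq ι] (p : MvPolynomial ι R) : linSubst (1 : Matrix ι ι R) p = p := by
  refine DFunLike.congr_fun (?_ : linSubst (1 : Matrix ι ι R) = AlgHom.id R _) p
  refine algHom_ext fun k => ?_
  rw [linSubst_X, AlgHom.id_apply, ← linForm_single]
  congr 1
  ext j
  rw [Matrix.one_apply, Pi.single_apply]
  exact if_congr eq_comm rfl rfl

lemma map_linSubst (f : R →+* S) (M : Matrix κ ι R) (p : MvPolynomial κ R) :
    MvPolynomial.map f (linSubst M p) = linSubst (M.map f) (MvPolynomial.map f p) := by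
  refine DFunLike.congr_fun (?_ : (MvPolynomial.map f).comp (linSubst M).toRingHom =
    (linSubst (M.map f)).toRingHom.comp (MvPolynomial.map f)) p
  refine ringHom_ext (fun a => ?_) fun k => ?_
  · simp [linSubst]
  · simp only [RingHom.comp_apply, AlgHom.toRingHom_eq_coe, RingHom.coe_coe, linSubst_X,
      map_linForm, map_X]
    rfl

lemma eval_linSubst (b : ι → R) (M : Matrix κ ι R) (p : MvPolynomial κ R) :
    eval b (linSubst M p) = eval (M *ᵥ b) p := by
  refine DFunLike.congr_fun (?_ : ((aeval b).comp (linSubst M)) = aeval (R := R) (M *ᵥ b)) p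
  refine algHom_ext fun k => ?_
  simp [linForm_apply, Matrix.mulVec, dotProduct]

lemma isHomogeneous_linSubst (M : Matrix κ ι R) {p : MvPolynomial κ R} {d : ℕ}
    (hp : p.IsHomogeneous d) : (linSubst M p).IsHomogeneous d :=
  one_mul d ▸ hp.aeval _ fun k => isHomogeneous_linForm (M k)

/-- Polarization: the coefficient of `a ^ m` in `(linForm a) ^ d` is a multinomial coefficient
times the monomial with exponent `m`. -/
lemma homogeneousSubmodule_le_span_linForm_pow {K : Type*} [Field K] [CharZero K]
    {p : MvPolynomial ι K} (hp : p ≠ 0) (d : ℕ) :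
    homogeneousSubmodule ι K d ≤
      Submodule.span K {q | ∃ a, eval a p ≠ 0 ∧ q = linForm a ^ d} := by
  set W := Submodule.span K {q | ∃ a, eval a p ≠ 0 ∧ q = linForm a ^ d}
  have coeff_mem (m : ι →₀ ℕ) :
      coeff m ((∑ j, (X j : MvPolynomial ι K) • X j : MvPolynomial ι (MvPolynomial ι K)) ^ d) ∈
        W := by
    refine coeff_mem_of_forall_eval_mem (W := W) hp
      (fun a ha => Submodule.subset_span ⟨a, ha, ?_⟩) m
    simp [linForm_apply, smul_eq_C_mul, mul_comm, algebraMap_eq]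
  intro q hq
  rw [q.as_sum]
  refine sum_mem fun m hm => ?_
  have degree_m : (m.sum fun _ n => n) = d := by
    simpa [Finsupp.weight_apply] using hq (mem_support_iff.1 hm)
  have multinomial_smul : (m.multinomial : K) • monomial m (1 : K) ∈ W := by
    have := coeff_mem m
    rwa [coeff_linearCombination_X_pow_of_fintype, if_pos degree_m, ← nsmul_eq_mul,
      ← Nat.cast_smul_eq_nsmul K, Finsupp.prod, prod_X_pow_eq_monomial] at this
  have multinomial_ne_zero : (m.multinomial : K) ≠ 0 :=
    Nat.cast_ne_zero.2 (Nat.multinomial_pos _ _).ne'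
  rw [W.smul_mem_iff multinomial_ne_zero] at multinomial_smul
  simpa [smul_monomial] using W.smul_mem (coeff m q) multinomial_smul

end LinearForms

/-! ### The Segre embedding and the ideal of minors -/

lemma prod_zipWith_eq_of_perm {α β M : Type*} [CommMonoid M] {f : α → β → M}
    (hf : ∀ a a' b b', f a b * f a' b' = f a b' * f a' b) {bs bs' : List β} (h : bs.Perm bs')
    {as : List α} (has : as.length = bs.length) :
    (List.zipWith f as bs).prod = (List.zipWith f as bs').prod := by
  induction h generalizing as with
  | nil => rfl
  | cons b _ ih =>
    obtain ⟨a, as, rfl⟩ := List.exists_cons_of_length_eq_add_one has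
    simp only [List.zipWith_cons_cons, List.prod_cons, ih (Nat.succ_injective has)]
  | swap b b' bs =>
    obtain ⟨a, as, rfl⟩ := List.exists_cons_of_length_eq_add_one has
    obtain ⟨a', as, rfl⟩ := List.exists_cons_of_length_eq_add_one (Nat.succ_injective has)
    simp only [List.zipWith_cons_cons, List.prod_cons, ← mul_assoc, hf a a' b']
  | trans h _ ih ih' => exact (ih has).trans (ih' (has.trans h.length_eq))

lemma prod_map_uncurry_eq_of_map_eq {α β M : Type*} [CommMonoid M] {f : α → β → M}
    (hf : ∀ a a' b b', f a b * f a' b' = f a b' * f a' b) {s t : Multiset (α × β)}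
    (hfst : s.map Prod.fst = t.map Prod.fst) (hsnd : s.map Prod.snd = t.map Prod.snd) :
    (s.map f.uncurry).prod = (t.map f.uncurry).prod := by
  induction s, t using Quotient.inductionOn₂ with | _ l l' =>
  simp only [Multiset.quot_mk_to_coe, Multiset.map_coe, Multiset.coe_eq_coe,
    Multiset.prod_coe] at hfst hsnd ⊢
  have prod_map (l : List (α × β)) : (l.map f.uncurry).prod =
      (List.zipWith f (l.map Prod.fst) (l.map Prod.snd)).prod := by
    rw [List.zipWith_map, List.zipWith_self]
    rfl
  rw [prod_map, prod_map, prod_zipWith_eq_of_perm hf hsnd (by simp), List.zipWith_comm,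
    List.zipWith_comm (as := l'.map Prod.fst)]
  exact prod_zipWith_eq_of_perm (fun b b' a a' => by rw [mul_comm, hf, mul_comm]) hfst
    (by simpa using hfst.length_eq.symm)

section Segre

variable {κ ι A : Type*} [CommRing A]

/-- The pullback of functions along `(w, z) ↦ w zᵀ`, which parametrizes the matrices of rank at most
one. A function of `w` and `z` is encoded as a polynomial in `w` whose coefficients are polynomials
in `z`. -/
noncomputable def segre : MvPolynomial (κ × ι) A →ₐ[A] MvPolynomial κ (MvPolynomial ι A) :=
  aeval fun p => X p.1 * C (X p.2)

@[simp]
lemma segre_X (p : κ × ι) : segre (X p : MvPolynomial (κ × ι) A) = X p.1 * C (X p.2) :=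
  aeval_X _ _

@[simp]
lemma segre_monomial (m : κ × ι →₀ ℕ) (a : A) :
    segre (monomial m a) =
      monomial (m.mapDomain Prod.fst) (monomial (m.mapDomain Prod.snd) a) := by
  induction m using Finsupp.induction_linear generalizing a with
  | zero => simp [segre, ← C_apply, MvPolynomial.algebraMap_apply]
  | add f g hf hg =>
    rw [← mul_one a, ← monomial_mul, map_mul, hf, hg, Finsupp.mapDomain_add,
      Finsupp.mapDomain_add, monomial_mul, monomial_mul]
  | single p n =>
    rw [Finsupp.mapDomain_single, Finsupp.mapDomain_single, ← C_mul_X_pow_eq_monomial, map_mul,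
      map_pow, segre_X, mul_pow, ← map_pow, ← mul_assoc, mul_right_comm, ← algebraMap_eq,
      AlgHom.commutes, MvPolynomial.algebraMap_apply, ← map_mul, ← C_mul_X_pow_eq_monomial,
      ← C_mul_X_pow_eq_monomial, algebraMap_eq]

lemma isHomogeneous_coeff_segre (f : MvPolynomial (κ × ι) A) (m : κ →₀ ℕ) :
    (coeff m (segre f)).IsHomogeneous m.degree := by
  classical
  rw [f.as_sum, map_sum, coeff_sum]
  refine IsHomogeneous.sum _ _ _ fun p _ => ?_
  rw [segre_monomial, coeff_monomial]
  split_ifs with hp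
  · exact isHomogeneous_monomial _ (by rw [← hp, Finsupp.degree_mapDomain,
      Finsupp.degree_mapDomain])
  · exact isHomogeneous_zero _ _ _

variable (κ ι A) in
/-- The ideal generated by the `2 × 2` minors of the generic matrix. -/
noncomputable def minorIdeal : Ideal (MvPolynomial (κ × ι) A) :=
  Ideal.span {f | ∃ k k' i j, f = X (k, i) * X (k', j) - X (k, j) * X (k', i)}

lemma mk_minorIdeal_monomial_eq {m m' : κ × ι →₀ ℕ}
    (hfst : m.mapDomain Prod.fst = m'.mapDomain Prod.fst)
    (hsnd : m.mapDomain Prod.snd = m'.mapDomain Prod.snd) :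
    Ideal.Quotient.mk (minorIdeal κ ι A) (monomial m 1) =
      Ideal.Quotient.mk (minorIdeal κ ι A) (monomial m' 1) := by
  let x (k : κ) (i : ι) := Ideal.Quotient.mk (minorIdeal κ ι A) (X (k, i))
  have mk_monomial (m : κ × ι →₀ ℕ) : Ideal.Quotient.mk (minorIdeal κ ι A) (monomial m 1) =
      (m.toMultiset.map x.uncurry).prod := by
    rw [monomial_eq, C_1, one_mul, Finsupp.toMultiset_map, Finsupp.prod_toMultiset,
      Finsupp.prod_mapDomain_index (by simp) (by simp [pow_add]), map_finsuppProd]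
    simp only [map_pow]
    rfl
  rw [mk_monomial, mk_monomial]
  refine prod_map_uncurry_eq_of_map_eq (fun k k' i j => ?_) ?_ ?_
  · simp only [x, ← map_mul]
    exact Ideal.Quotient.eq.2 (Ideal.subset_span ⟨k, k', i, j, rfl⟩)
  · rw [Finsupp.toMultiset_map, Finsupp.toMultiset_map, hfst]
  · rw [Finsupp.toMultiset_map, Finsupp.toMultiset_map, hsnd]

/-- The class of a monomial modulo the minors only depends on its image under `segre`, which is
again a monomial; this gives an `A`-linear `θ` with `θ ∘ segre` equal to the quotient map. -/
lemma ker_segre_le_minorIdeal :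
    RingHom.ker (segre : MvPolynomial (κ × ι) A →ₐ[A] _) ≤ minorIdeal κ ι A := by
  let marginals (m : κ × ι →₀ ℕ) := (m.mapDomain Prod.snd, m.mapDomain Prod.fst)
  let mk : MvPolynomial (κ × ι) A →ₗ[A] _ := (Ideal.Quotient.mkₐ A (minorIdeal κ ι A)).toLinearMap
  let θ : MvPolynomial κ (MvPolynomial ι A) →ₗ[A] MvPolynomial (κ × ι) A ⧸ minorIdeal κ ι A :=
    ((basisMonomials ι A).smulTower (basisMonomials κ (MvPolynomial ι A))).constr A
      (Function.extend marginals (fun m => mk (monomial m 1)) 0)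
  have factors : Function.FactorsThrough (fun m => mk (monomial m 1)) marginals :=
    fun m m' h => mk_minorIdeal_monomial_eq (congrArg Prod.snd h) (congrArg Prod.fst h)
  have θ_monomial (m : κ × ι →₀ ℕ) : θ (segre (monomial m 1)) = mk (monomial m 1) := by
    have := ((basisMonomials ι A).smulTower (basisMonomials κ (MvPolynomial ι A))).constr_basis A
      (Function.extend marginals (fun m => mk (monomial m 1)) 0) (marginals m)
    rw [factors.extend_apply] at this
    rw [← this]
    congr 1
    simp [marginals, smul_monomial]
  have θ_segre : θ ∘ₗ segre.toLinearMap = mk :=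
    (basisMonomials (κ × ι) A).ext fun m => by simpa using θ_monomial m
  intro f hf
  rw [← Ideal.Quotient.eq_zero_iff_mem]
  refine (LinearMap.congr_fun θ_segre f).symm.trans ?_
  rw [LinearMap.comp_apply, AlgHom.toLinearMap_apply, (RingHom.mem_ker).1 hf, map_zero]

end Segre

/-! ### Ideals stable under multiplication by matrices -/

section MatStable

variable {κ ι A : Type*} [Fintype κ] [CommRing A]

/-- The substitution of `h X` for the generic matrix `X`. -/
noncomputable def rowSubst (h : Matrix κ κ A) :
    MvPolynomial (κ × ι) A →ₐ[A] MvPolynomial (κ × ι) A :=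
  aeval fun p => ∑ l, h p.1 l • X (l, p.2)

@[simp]
lemma rowSubst_X (h : Matrix κ κ A) (p : κ × ι) :
    rowSubst h (X p) = ∑ l, h p.1 l • X (l, p.2) :=
  aeval_X _ _

lemma rowSubst_rowSubst (g h : Matrix κ κ A) (f : MvPolynomial (κ × ι) A) :
    rowSubst g (rowSubst h f) = rowSubst (h * g) f := by
  refine DFunLike.congr_fun (?_ : (rowSubst g).comp (rowSubst h) = rowSubst (h * g)) f
  refine algHom_ext fun p => ?_
  simp only [AlgHom.comp_apply, rowSubst_X, map_sum, map_smul, Matrix.mul_apply, Finset.sum_smul,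
    Finset.smul_sum, mul_smul]
  exact Finset.sum_comm

variable (κ ι A) in
/-- The coaction dual to the multiplication of matrices: the substitution of `H X` for the generic
matrix `X`, where `H` is a generic square matrix. The entries of `H` are the outer variables. -/
noncomputable def coaction :
    MvPolynomial (κ × ι) A →ₐ[A] MvPolynomial (κ × κ) (MvPolynomial (κ × ι) A) :=
  aeval fun p => ∑ l, X (p.1, l) * C (X (l, p.2))

@[simp]
lemma coaction_X (p : κ × ι) :
    coaction κ ι A (X p) = ∑ l, X (p.1, l) * C (X (l, p.2)) :=
  aeval_X _ _

lemma eval_coaction (h : Matrix κ κ A) (f : MvPolynomial (κ × ι) A) :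
    eval (fun q => C (h q.1 q.2)) (coaction κ ι A f) = rowSubst h f := by
  refine DFunLike.congr_fun (?_ : ((aeval (R := MvPolynomial (κ × ι) A)
    fun q : κ × κ => C (h q.1 q.2)).restrictScalars A).comp (coaction κ ι A) = rowSubst h) f
  refine algHom_ext fun p => ?_
  simp [smul_eq_C_mul]

/-- The closed subscheme cut out by `I` is stable under left multiplication by matrices. -/
def IsMatStable (I : Ideal (MvPolynomial (κ × ι) A)) : Prop :=
  I ≤ (I.map C).comap (coaction κ ι A)

variable {I : Ideal (MvPolynomial (κ × ι) A)}

lemma IsMatStable.rowSubst_mem (hI : IsMatStable I) (h : Matrix κ κ A) {f : MvPolynomial (κ × ι) A}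
    (hf : f ∈ I) : rowSubst h f ∈ I := by
  let ev : MvPolynomial (κ × κ) (MvPolynomial (κ × ι) A) →+* MvPolynomial (κ × ι) A :=
    eval fun q => C (h q.1 q.2)
  have ev_comp_C : ev.comp C = RingHom.id _ := RingHom.ext fun g => eval_C g
  have := Ideal.mem_map_of_mem ev (Ideal.mem_comap.1 (hI hf))
  rw [Ideal.map_map, ev_comp_C, Ideal.map_id] at this
  exact eval_coaction h f ▸ this

lemma isMatStable_span {S : Set (MvPolynomial (κ × ι) A)}
    (hS : ∀ f ∈ S, coaction κ ι A f ∈ (Ideal.span S).map C) : IsMatStable (Ideal.span S) :=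
  Ideal.span_le.2 hS

lemma isMatStable_top : IsMatStable (⊤ : Ideal (MvPolynomial (κ × ι) A)) := by
  rw [IsMatStable, Ideal.map_top, Ideal.comap_top]

lemma isMatStable_minorIdeal : IsMatStable (minorIdeal κ ι A) := by
  refine isMatStable_span ?_
  rintro _ ⟨k, k', i, j, rfl⟩
  have : coaction κ ι A (X (k, i) * X (k', j) - X (k, j) * X (k', i)) =
      ∑ l, ∑ l', X (k, l) * X (k', l') * C (X (l, i) * X (l', j) - X (l, j) * X (l', i)) := by
    simp only [map_sub, map_mul, coaction_X, Finset.sum_mul_sum, ← Finset.sum_sub_distrib]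
    exact Finset.sum_congr rfl fun l _ => Finset.sum_congr rfl fun l' _ => by ring
  rw [this]
  exact sum_mem fun l _ => sum_mem fun l' _ => Ideal.mul_mem_left _ _
    (Ideal.mem_map_of_mem C (Ideal.subset_span ⟨l, l', i, j, rfl⟩))

/-- The polynomials in the entries of row `k` that lie in `I`. -/
noncomputable def rowIdeal (k : κ) (I : Ideal (MvPolynomial (κ × ι) A)) :
    Ideal (MvPolynomial ι A) :=
  I.comap (rename (Prod.mk k))

omit [Fintype κ] in
lemma segre_rename {c : MvPolynomial ι A} {d : ℕ} (hc : c.IsHomogeneous d) (k : κ) :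
    segre (rename (Prod.mk k) c) = X k ^ d * C c := by
  have segre_rename_monomial {m : ι →₀ ℕ} (hm : m ∈ c.support) (a : A) :
      segre (rename (Prod.mk k) (monomial m a)) = X k ^ d * C (monomial m a) := by
    have degree_m : m.sum (fun _ => (Finsupp.single k : ℕ → κ →₀ ℕ)) = Finsupp.single k d := by
      rw [← hc (mem_support_iff.1 hm), Finsupp.weight_apply, Finsupp.sum, Finsupp.sum,
        Finsupp.single_finsetSum]
      simp
    rw [rename_monomial, segre_monomial, ← Finsupp.mapDomain_comp, ← Finsupp.mapDomain_comp]
    change monomial (m.sum fun _ => Finsupp.single k) (monomial (m.mapDomain id) a) = _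
    rw [degree_m, Finsupp.mapDomain_id, mul_comm, C_mul_X_pow_eq_monomial]
  rw [c.as_sum]
  simp only [map_sum, Finset.mul_sum]
  exact Finset.sum_congr rfl fun m hm => segre_rename_monomial hm _

lemma segre_rowSubst (h : Matrix κ κ A) (f : MvPolynomial (κ × ι) A) :
    segre (rowSubst h f) = linSubst (h.map C) (segre f) := by
  refine DFunLike.congr_fun (?_ : segre.comp (rowSubst h) =
    ((linSubst (h.map C)).restrictScalars A).comp segre) f
  refine algHom_ext fun p => ?_
  simp [linForm_apply, smul_eq_C_mul, Finset.sum_mul, algHom_C, mul_assoc]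

/-- `(w, z) ↦ w zᵀ` factors through the action on `(e_k) zᵀ`, a matrix with only row `k`. -/
lemma IsMatStable.segre_mem_map_rowIdeal (hI : IsMatStable I) (k : κ) {f : MvPolynomial (κ × ι) A}
    (hf : f ∈ I) : segre f ∈ (rowIdeal k I).map C := by
  classical
  let firstColumn : MvPolynomial (κ × κ) (MvPolynomial (κ × ι) A) →ₐ[MvPolynomial (κ × ι) A]
    MvPolynomial κ (MvPolynomial (κ × ι) A) := aeval fun q => if q.2 = k then X q.1 else 0
  have map_segre : MvPolynomial.map (rename (Prod.mk k)).toRingHom (segre f) =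
      firstColumn (coaction κ ι A f) := by
    refine DFunLike.congr_fun (?_ : (mapAlgHom (rename (Prod.mk k))).comp segre =
      (firstColumn.restrictScalars A).comp (coaction κ ι A)) f
    refine algHom_ext fun p => ?_
    simp [firstColumn, algHom_C]
  rw [mem_map_C_iff]
  intro m
  have := Ideal.mem_map_of_mem firstColumn.toRingHom (Ideal.mem_comap.1 (hI hf))
  have comp_C : firstColumn.toRingHom.comp C = C := RingHom.ext fun g => algHom_C firstColumn g
  rw [Ideal.map_map, comp_C] at this
  rw [rowIdeal, Ideal.mem_comap]
  have h := congrArg (coeff m) map_segre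
  rw [coeff_map] at h
  exact h ▸ mem_map_C_iff.1 this m

/-- The forms `h · (x_k ↦ c)` with `h` running over the matrices map to `ℓ ^ d c` with `ℓ` running
over all linear forms. -/
lemma IsMatStable.exists_segre_eq {K : Type*} [Field K] [CharZero K] [Algebra K A]
    (hI : IsMatStable I) {k : κ} {c : MvPolynomial ι A} {d : ℕ} (hc : c.IsHomogeneous d)
    (hcI : c ∈ rowIdeal k I) {q : MvPolynomial κ K} (hq : q.IsHomogeneous d) :
    ∃ f ∈ I, segre f = MvPolynomial.map (algebraMap K (MvPolynomial ι A)) q * C c := by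
  let mulC : MvPolynomial κ K →ₗ[K] MvPolynomial κ (MvPolynomial ι A) :=
    (LinearMap.mulRight K (C c)).comp (mapAlgHom (Algebra.ofId K (MvPolynomial ι A))).toLinearMap
  let W := (I.restrictScalars K).map (segre.toLinearMap.restrictScalars K)
  suffices homogeneousSubmodule κ K d ≤ W.comap mulC from this hq
  refine (homogeneousSubmodule_le_span_linForm_pow one_ne_zero d).trans (Submodule.span_le.2 ?_)
  rintro _ ⟨a, -, rfl⟩
  refine ⟨rowSubst (Matrix.of fun _ l => algebraMap K A (a l)) (rename (Prod.mk k) c),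
    hI.rowSubst_mem _ hcI, ?_⟩
  change segre (rowSubst _ _) = MvPolynomial.map (algebraMap K _) (linForm a ^ d) * C c
  rw [segre_rowSubst, segre_rename hc, map_mul, map_pow, linSubst_X, map_pow, map_linForm,
    linSubst, algHom_C, algebraMap_eq]
  rfl

lemma IsMatStable.eq_comap_segre (K : Type*) [Field K] [CharZero K] [Algebra K A]
    (hI : IsMatStable I) (hm : minorIdeal κ ι A ≤ I) (k : κ) :
    I = ((rowIdeal k I).map C).comap segre := by
  refine le_antisymm (fun f hf => hI.segre_mem_map_rowIdeal k hf) fun f hf => ?_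
  have exists_monomial (m : κ →₀ ℕ) :
      ∃ g ∈ I, segre g = monomial m (coeff m (segre f)) := by
    obtain ⟨g, hg, h⟩ := hI.exists_segre_eq (K := K) (isHomogeneous_coeff_segre f m)
      (mem_map_C_iff.1 hf m) (isHomogeneous_monomial 1 rfl)
    exact ⟨g, hg, by rw [h, map_monomial, map_one, mul_comm, C_mul_monomial, mul_one]⟩
  choose g g_mem segre_g using exists_monomial
  have hsum : segre (∑ m ∈ (segre f).support, g m) = segre f := by
    rw [map_sum, Finset.sum_congr rfl fun m _ => segre_g m, ← as_sum]
  have : f - ∑ m ∈ (segre f).support, g m ∈ I :=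
    hm (ker_segre_le_minorIdeal (RingHom.mem_ker.2 (by rw [map_sub, hsum, sub_self])))
  exact sub_add_cancel f (∑ m ∈ (segre f).support, g m) ▸
    I.add_mem this (I.sum_mem fun m _ => g_mem m)

end MatStable

section Actions

variable {A : Type u} [CommRing A] [Algebra ℂ A]

lemma slAct_eq_rowSubst (g : SL(2, ℂ)) :
    slAct A g =
      rowSubst (((g⁻¹ : SL(2, ℂ)) : Matrix (Fin 2) (Fin 2) ℂ).map (algebraMap ℂ A)) := by
  refine algHom_ext fun p => ?_
  simp only [slAct, MonoidHom.coe_mk, OneHom.coe_mk, aeval_X, rowSubst_X, Matrix.mul_apply,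
    Matrix.map_apply, MvPolynomial.algebraMap_apply, Matrix.mvPolynomialX_apply, smul_eq_C_mul]

lemma scaleAct_eq_rowSubst (t : ℂˣ) :
    scaleAct A t =
      rowSubst ((((t⁻¹ : ℂˣ) : ℂ) • (1 : Matrix (Fin 2) (Fin 2) ℂ)).map (algebraMap ℂ A)) := by
  refine algHom_ext fun p => ?_
  obtain ⟨k, j⟩ := p
  simp only [scaleAct, MonoidHom.coe_mk, OneHom.coe_mk, aeval_X, rowSubst_X, Matrix.map_apply,
    Matrix.smul_apply, Matrix.one_apply, smul_eq_mul, mul_one, mul_zero, apply_ite,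
    map_zero, ite_smul, zero_smul, Finset.sum_ite_eq, Finset.mem_univ, if_true,
    MvPolynomial.algebraMap_apply, smul_eq_C_mul]

lemma binAct_eq_linSubst (g : SL(2, ℂ)) :
    binAct g = linSubst ((g⁻¹ : SL(2, ℂ)) : Matrix (Fin 2) (Fin 2) ℂ) := by
  refine algHom_ext fun k => ?_
  simp only [binAct, MonoidHom.coe_mk, OneHom.coe_mk, aeval_X, linSubst_X, linForm_apply,
    Matrix.mulVec, dotProduct, Matrix.map_apply, smul_eq_C_mul]

variable {I : Ideal (CoordRing A)}

/-- Every invertible matrix over `ℂ` is a scalar multiple of a matrix of determinant one. -/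
lemma SlStable.rowSubst_mem (hI : SlStable I) (ht : ∀ t : ℂˣ, I.map (scaleAct A t) = I)
    {h : Matrix (Fin 2) (Fin 2) ℂ} (hh : h.det ≠ 0) {f : CoordRing A} (hf : f ∈ I) :
    rowSubst (h.map (algebraMap ℂ A)) f ∈ I := by
  obtain ⟨s, hs⟩ := IsAlgClosed.exists_pow_nat_eq h.det two_pos
  have hs0 : s ≠ 0 := by
    rintro rfl
    exact hh (by simpa using hs.symm)
  let g : SL(2, ℂ) := ⟨s⁻¹ • h, by
    rw [Matrix.det_smul, Fintype.card_fin, ← hs, inv_pow, inv_mul_cancel₀ (pow_ne_zero 2 hs0)]⟩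
  have h_eq : (g : Matrix (Fin 2) (Fin 2) ℂ) * (s • 1) = h := by
    simp [g, smul_smul, hs0]
  have := Ideal.mem_map_of_mem (scaleAct A (Units.mk0 s hs0)⁻¹) (Ideal.mem_comap.1 (hI g⁻¹ hf))
  rwa [ht, scaleAct_eq_rowSubst, slAct_eq_rowSubst, rowSubst_rowSubst, ← Matrix.map_mul, inv_inv,
    inv_inv, Units.val_mk0, h_eq] at this

lemma isMatStable_iff :
    IsMatStable I ↔ SlStable I ∧ ∀ t : ℂˣ, I.map (scaleAct A t) = I := by
  constructor
  · intro hI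
    have scaleAct_mem (t : ℂˣ) {f : CoordRing A} (hf : f ∈ I) : scaleAct A t f ∈ I :=
      scaleAct_eq_rowSubst (A := A) t ▸ hI.rowSubst_mem _ hf
    refine ⟨fun g f hf => slAct_eq_rowSubst (A := A) g ▸ hI.rowSubst_mem _ hf, fun t => ?_⟩
    refine le_antisymm (Ideal.map_le_iff_le_comap.2 fun f hf => scaleAct_mem t hf) fun f hf => ?_
    have : scaleAct A t (scaleAct A t⁻¹ f) = f := by
      rw [← AlgHom.mul_apply, ← map_mul, mul_inv_cancel, map_one, AlgHom.one_apply]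
    exact this ▸ Ideal.mem_map_of_mem _ (scaleAct_mem t⁻¹ hf)
  · rintro ⟨hI, ht⟩ f hf
    rw [Ideal.mem_comap, mem_map_C_iff]
    refine coeff_mem_of_forall_eval_mem (W := I.restrictScalars ℂ)
      (Matrix.det_mvPolynomialX_ne_zero (Fin 2) ℂ) fun a ha => ?_
    have det_ne_zero : (Matrix.of fun k l => a (k, l)).det ≠ 0 := by
      rwa [Matrix.eval_det_mvPolynomialX] at ha
    have := hI.rowSubst_mem ht det_ne_zero hf
    rwa [← eval_coaction] at this

end Actions

lemma minor_eq (A : Type u) [CommRing A] (i j : Fin 6) :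
    minor A i j = X (0, i) * X (1, j) - X (0, j) * X (1, i) := by
  simp [minor, Matrix.det_fin_two]

lemma minorIdeal_eq_span_minor (A : Type u) [CommRing A] :
    minorIdeal (Fin 2) (Fin 6) A = Ideal.span {f | ∃ i j, f = minor A i j} := by
  refine le_antisymm (Ideal.span_le.2 ?_) (Ideal.span_mono ?_)
  · rintro _ ⟨k, l, i, j, rfl⟩
    have minor_mem (i j) : minor A i j ∈ Ideal.span {f | ∃ i j, f = minor A i j} :=
      Ideal.subset_span ⟨i, j, rfl⟩
    fin_cases k <;> fin_cases l
    · simp [mul_comm]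
    · exact minor_eq A i j ▸ minor_mem i j
    · have minor_swap : minor A j i = X (1, i) * X (0, j) - X (1, j) * X (0, i) := by
        rw [minor_eq]
        ring
      exact minor_swap ▸ minor_mem j i
    · simp [mul_comm]
  · rintro _ ⟨i, j, rfl⟩
    exact ⟨0, 1, i, j, minor_eq A i j⟩

lemma minor_mem_minorIdeal (A : Type u) [CommRing A] (i j : Fin 6) :
    minor A i j ∈ minorIdeal (Fin 2) (Fin 6) A :=
  minorIdeal_eq_span_minor A ▸ Ideal.subset_span ⟨i, j, rfl⟩

/-! ### Modules of covariants -/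

section HighestWeight

/-- The highest weight vector `x ^ d` of `V_d`. -/
noncomputable def highestWeightVector (d : ℕ) : BinForm d :=
  ⟨X 0 ^ d, isHomogeneous_X_pow 0 d⟩

lemma coe_binRep (d : ℕ) (g : SL(2, ℂ)) (p : BinForm d) :
    (binRep d g p : MvPolynomial (Fin 2) ℂ) =
      linSubst ((g⁻¹ : SL(2, ℂ)) : Matrix (Fin 2) (Fin 2) ℂ) p :=
  DFunLike.congr_fun (binAct_eq_linSubst g) (p : MvPolynomial (Fin 2) ℂ)

lemma span_range_binRep_highestWeightVector (d : ℕ) :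
    Submodule.span ℂ (Set.range fun g => binRep d g (highestWeightVector d)) = ⊤ := by
  refine Submodule.map_injective_of_injective (Submodule.injective_subtype _)
    (le_antisymm (Submodule.map_mono le_top) ?_)
  rw [Submodule.map_top, Submodule.range_subtype, Submodule.map_span]
  refine (homogeneousSubmodule_le_span_linForm_pow (X_ne_zero 0) d).trans (Submodule.span_mono ?_)
  rintro _ ⟨a, ha, rfl⟩
  rw [eval_X] at ha
  let g : SL(2, ℂ) := ⟨!![a 0, a 1; 0, (a 0)⁻¹], by simp [Matrix.det_fin_two, ha]⟩
  refine ⟨_, ⟨g⁻¹, rfl⟩, ?_⟩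
  have row_g : (g : Matrix (Fin 2) (Fin 2) ℂ) 0 = a := by
    ext k
    fin_cases k <;> rfl
  rw [Submodule.subtype_apply, coe_binRep, inv_inv, highestWeightVector, map_pow, linSubst_X, row_g]

variable {B : Type*} [CommRing B] [Algebra ℂ B] {d : ℕ}

variable (d) in
/-- The equivariant map `p ↦ β p`. -/
noncomputable def mulBinForm (β : B) : BinForm d →ₗ[ℂ] MvPolynomial (Fin 2) B :=
  ((LinearMap.mulRight ℂ (C β)).comp (mapAlgHom (Algebra.ofId ℂ B)).toLinearMap).comp
    (Submodule.subtype _)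

lemma mulBinForm_apply (β : B) (p : BinForm d) :
    mulBinForm d β p = MvPolynomial.map (algebraMap ℂ B) p * C β :=
  rfl

lemma mulBinForm_highestWeightVector (β : B) :
    mulBinForm d β (highestWeightVector d) = X 0 ^ d * C β := by
  rw [mulBinForm_apply, highestWeightVector, map_pow, map_X]

lemma mulBinForm_binRep (β : B) (g : SL(2, ℂ)) (p : BinForm d) :
    mulBinForm d β (binRep d g p) =
      linSubst (((g⁻¹ : SL(2, ℂ)) : Matrix (Fin 2) (Fin 2) ℂ).map (algebraMap ℂ B))
        (mulBinForm d β p) := by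
  rw [mulBinForm_apply, mulBinForm_apply, coe_binRep, map_linSubst, map_mul]
  congr 1
  rw [linSubst, algHom_C, algebraMap_eq]

/-- The Borel subgroup moves the point `(1, 0)` to all points off the line `x = 0`. -/
lemma eq_X_pow_mul_C_of_linSubst_eq {y : MvPolynomial (Fin 2) B}
    (hy : ∀ s u : ℂ, s ≠ 0 →
      linSubst (!![s, 0; u, s⁻¹].map (algebraMap ℂ B)) y = algebraMap ℂ B (s ^ d) • y) :
    y = X 0 ^ d * C (coeff (Finsupp.single 0 d) y) := by
  suffices h : y = X 0 ^ d * C (eval ![1, 0] y) by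
    have := congrArg (coeff (Finsupp.single 0 d)) h
    rw [mul_comm, coeff_C_mul, X_pow_eq_monomial, coeff_monomial, if_pos rfl, mul_one] at this
    rwa [this]
  rw [← sub_eq_zero]
  ext m
  refine coeff_mem_of_forall_eval_mem (W := (⊥ : Submodule ℂ B))
    (X_ne_zero (R := ℂ) (0 : Fin 2)) (fun a ha => ?_) m
  rw [eval_X] at ha
  have orbit : (!![a 0, 0; a 1, (a 0)⁻¹].map (algebraMap ℂ B)) *ᵥ ![1, 0] =
      fun i => algebraMap ℂ B (a i) := by
    ext k
    fin_cases k <;> simp [Matrix.mulVec, dotProduct]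
  have := congrArg (eval ![1, 0]) (hy (a 0) (a 1) ha)
  rw [eval_linSubst, orbit] at this
  rw [Submodule.mem_bot, map_sub, this]
  simp [smul_eq_C_mul]

lemma eq_mulBinForm_of_equivariant (φ : BinForm d →ₗ[ℂ] MvPolynomial (Fin 2) B)
    (hφ : ∀ g p, φ (binRep d g p) =
      linSubst (((g⁻¹ : SL(2, ℂ)) : Matrix (Fin 2) (Fin 2) ℂ).map (algebraMap ℂ B)) (φ p)) :
    φ = mulBinForm d (coeff (Finsupp.single 0 d) (φ (highestWeightVector d))) := by
  have hy : φ (highestWeightVector d) =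
      X 0 ^ d * C (coeff (Finsupp.single 0 d) (φ (highestWeightVector d))) := by
    refine eq_X_pow_mul_C_of_linSubst_eq fun s u hs => ?_
    let g : SL(2, ℂ) := ⟨!![s, 0; u, s⁻¹], by simp [Matrix.det_fin_two, hs]⟩
    have smul_highest : binRep d g⁻¹ (highestWeightVector d) = s ^ d • highestWeightVector d := by
      refine Subtype.ext ?_
      rw [coe_binRep, inv_inv]
      simp [g, highestWeightVector, linForm_apply, smul_pow]
    have := hφ g⁻¹ (highestWeightVector d)
    rw [inv_inv, smul_highest, map_smul, ← algebraMap_smul B] at this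
    exact this.symm
  refine LinearMap.ext_on_range (span_range_binRep_highestWeightVector d) fun g => ?_
  rw [hφ, mulBinForm_binRep, mulBinForm_highestWeightVector, ← hy]

end HighestWeight

section QuotSegre

variable {κ ι A : Type*} [Fintype κ] [CommRing A] {I : Ideal (MvPolynomial (κ × ι) A)}

/-- For a stable `I`, the map induced by `segre` on the functions on the subscheme cut out
by `I`. -/
noncomputable def IsMatStable.quotSegre (hI : IsMatStable I) (k : κ) :
    (MvPolynomial (κ × ι) A ⧸ I) →ₐ[A] MvPolynomial κ (MvPolynomial ι A ⧸ rowIdeal k I) :=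
  Ideal.Quotient.liftₐ I ((mapAlgHom (Ideal.Quotient.mkₐ A (rowIdeal k I))).comp segre)
    fun f hf => by
      have := hI.segre_mem_map_rowIdeal k hf
      ext m
      exact Ideal.Quotient.eq_zero_iff_mem.2 (mem_map_C_iff.1 this m)

lemma IsMatStable.quotSegre_mk (hI : IsMatStable I) (k : κ) (f : MvPolynomial (κ × ι) A) :
    hI.quotSegre k (Ideal.Quotient.mk I f) =
      MvPolynomial.map (Ideal.Quotient.mk (rowIdeal k I)) (segre f) :=
  rfl

lemma IsMatStable.quotSegre_injective (K : Type*) [Field K] [CharZero K] [Algebra K A]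
    (hI : IsMatStable I) (hm : minorIdeal κ ι A ≤ I) (k : κ) :
    Function.Injective (hI.quotSegre k) := by
  rw [injective_iff_map_eq_zero]
  intro x hx
  obtain ⟨f, rfl⟩ := Ideal.Quotient.mk_surjective x
  rw [Ideal.Quotient.eq_zero_iff_mem, hI.eq_comap_segre K hm k, Ideal.mem_comap, mem_map_C_iff]
  intro m
  rw [← Ideal.Quotient.eq_zero_iff_mem, ← coeff_map, ← hI.quotSegre_mk, hx, coeff_zero]

lemma IsMatStable.exists_quotSegre_eq {K : Type*} [Field K] [CharZero K] [Algebra K A]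
    (hI : IsMatStable I) {k : κ} {d : ℕ} {c : MvPolynomial ι A} (hc : c.IsHomogeneous d)
    {q : MvPolynomial κ K} (hq : q.IsHomogeneous d) :
    ∃ x, hI.quotSegre k x = MvPolynomial.map (algebraMap K _) q * C (Ideal.Quotient.mk _ c) := by
  obtain ⟨f, -, hf⟩ := isMatStable_top.exists_segre_eq (k := k) hc trivial hq
  refine ⟨Ideal.Quotient.mk I f, ?_⟩
  rw [hI.quotSegre_mk, hf, map_mul, map_C, map_map]
  rfl

end QuotSegre

/-- The degree `d` part of the quotient of the polynomial ring by `N`. -/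
noncomputable def gradedPiece {ι A : Type*} [CommRing A] (N : Ideal (MvPolynomial ι A)) (d : ℕ) :
    Submodule A (MvPolynomial ι A ⧸ N) :=
  (homogeneousSubmodule ι A d).map (Ideal.Quotient.mkₐ A N).toLinearMap

section Covariants

variable {A : Type u} [CommRing A] [Algebra ℂ A] {I : Ideal (CoordRing A)}

lemma IsMatStable.slStable (hI : IsMatStable I) : SlStable I :=
  (isMatStable_iff.1 hI).1

lemma IsMatStable.quotSegre_slActQuot (hI : IsMatStable I) (k : Fin 2) (g : SL(2, ℂ))
    (x : CoordRing A ⧸ I) :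
    hI.quotSegre k (slActQuot I hI.slStable g x) =
      linSubst (((g⁻¹ : SL(2, ℂ)) : Matrix (Fin 2) (Fin 2) ℂ).map (algebraMap ℂ _))
        (hI.quotSegre k x) := by
  obtain ⟨f, rfl⟩ := Ideal.Quotient.mk_surjective x
  change hI.quotSegre k (Ideal.Quotient.mk I (slAct A g f)) = _
  rw [hI.quotSegre_mk, slAct_eq_rowSubst, segre_rowSubst, map_linSubst, hI.quotSegre_mk]
  rfl

/-- A covariant is determined by the first-row polynomial in the image of the highest weight
vector. -/
noncomputable def IsMatStable.covariantsToRow (hI : IsMatStable I) (d : ℕ) :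
    covariants I hI.slStable d →ₗ[A] MvPolynomial (Fin 6) A ⧸ rowIdeal 0 I where
  toFun φ := coeff (Finsupp.single 0 d) (hI.quotSegre 0 (φ.1 (highestWeightVector d)))
  map_add' φ ψ := by simp
  map_smul' a φ := by simp [coeff_smul]

lemma IsMatStable.quotSegre_covariant (hI : IsMatStable I) {d : ℕ}
    (φ : covariants I hI.slStable d) (p : BinForm d) :
    hI.quotSegre 0 (φ.1 p) = mulBinForm d (hI.covariantsToRow d φ) p := by
  refine DFunLike.congr_fun (eq_mulBinForm_of_equivariant
    (((hI.quotSegre 0).restrictScalars ℂ).toLinearMap.comp φ.1) fun g p => ?_) p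
  simp only [LinearMap.comp_apply, AlgHom.toLinearMap_apply, AlgHom.restrictScalars_apply]
  rw [φ.2 g p, hI.quotSegre_slActQuot]

lemma IsMatStable.covariantsToRow_injective (hI : IsMatStable I)
    (hm : minorIdeal (Fin 2) (Fin 6) A ≤ I) (d : ℕ) :
    Function.Injective (hI.covariantsToRow d) := fun φ ψ h =>
  Subtype.ext (LinearMap.ext fun p => hI.quotSegre_injective ℂ hm 0 (by
    rw [hI.quotSegre_covariant, hI.quotSegre_covariant, h]))

lemma IsMatStable.range_covariantsToRow (hI : IsMatStable I)
    (hm : minorIdeal (Fin 2) (Fin 6) A ≤ I) (d : ℕ) :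
    LinearMap.range (hI.covariantsToRow d) = gradedPiece (rowIdeal 0 I) d := by
  refine le_antisymm ?_ ?_
  · rintro _ ⟨φ, rfl⟩
    obtain ⟨f, hf⟩ := Ideal.Quotient.mk_surjective (φ.1 (highestWeightVector d))
    have hom := isHomogeneous_coeff_segre f (Finsupp.single 0 d)
    rw [Finsupp.degree_single] at hom
    refine ⟨coeff (Finsupp.single 0 d) (segre f), hom, ?_⟩
    change _ = coeff (Finsupp.single 0 d) (hI.quotSegre 0 (φ.1 (highestWeightVector d)))
    rw [← hf, hI.quotSegre_mk, coeff_map]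
    rfl
  · rintro _ ⟨c, hc, rfl⟩
    let β : MvPolynomial (Fin 6) A ⧸ rowIdeal 0 I := Ideal.Quotient.mk _ c
    let e := LinearEquiv.ofInjective ((hI.quotSegre 0).restrictScalars ℂ).toLinearMap
      (hI.quotSegre_injective ℂ hm 0)
    let φ : BinForm d →ₗ[ℂ] CoordRing A ⧸ I := e.symm.toLinearMap.comp
      ((mulBinForm d β).codRestrict _ fun p => hI.exists_quotSegre_eq hc p.2)
    have quotSegre_φ (p : BinForm d) : hI.quotSegre 0 (φ p) = mulBinForm d β p :=
      congrArg Subtype.val (e.apply_symm_apply ⟨mulBinForm d β p, hI.exists_quotSegre_eq hc p.2⟩)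
    have hφ : φ ∈ covariants I hI.slStable d := fun g p => hI.quotSegre_injective ℂ hm 0 (by
      rw [hI.quotSegre_slActQuot, quotSegre_φ, quotSegre_φ, mulBinForm_binRep])
    refine ⟨⟨φ, hφ⟩, ?_⟩
    change coeff (Finsupp.single 0 d) (hI.quotSegre 0 (φ (highestWeightVector d))) = β
    rw [quotSegre_φ, mulBinForm_highestWeightVector, mul_comm, coeff_C_mul, X_pow_eq_monomial,
      coeff_monomial, if_pos rfl, mul_one]

/-- The covariants of type `V_d` are the degree `d` part of the functions of the first row. -/
noncomputable def IsMatStable.covariantsEquiv (hI : IsMatStable I)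
    (hm : minorIdeal (Fin 2) (Fin 6) A ≤ I) (d : ℕ) :
    covariants I hI.slStable d ≃ₗ[A] gradedPiece (rowIdeal 0 I) d :=
  (LinearEquiv.ofInjective _ (hI.covariantsToRow_injective hm d)).trans
    (LinearEquiv.ofEq _ _ (hI.range_covariantsToRow hm d))

end Covariants

/-! ### Locally free modules and idempotents -/

section LocallyFree

variable {A M M' : Type u} [CommRing A] [AddCommGroup M] [Module A M] [AddCommGroup M']
  [Module A M'] {n : ℕ}

lemma IsLocallyFreeOfRank.of_equiv (h : IsLocallyFreeOfRank A M n) (e : M ≃ₗ[A] M') :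
    IsLocallyFreeOfRank A M' n := by
  obtain ⟨hfin, hproj, hrank⟩ := h
  exact ⟨Module.Finite.equiv e, Module.Projective.of_equiv e,
    fun p => by rw [← Module.rankAtStalk_eq_of_equiv e, hrank]⟩

lemma IsLocallyFreeOfRank.bijective_of_surjective (h : IsLocallyFreeOfRank A M n)
    (h' : IsLocallyFreeOfRank A M' n) {φ : M →ₗ[A] M'} (hφ : Function.Surjective φ) :
    Function.Bijective φ := by
  obtain ⟨_, _, hrank⟩ := h
  obtain ⟨_, _, hrank'⟩ := h'
  exact Module.bijective_of_surjective_of_rankAtStalk_eq hφ fun p _ => by rw [hrank, hrank']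

end LocallyFree

section Idempotents

variable {A M : Type*} [CommRing A] [AddCommGroup M] [Module A M]

lemma projective_range_of_isIdempotentElem [Module.Projective A M] {e : Module.End A M}
    (he : IsIdempotentElem e) : Module.Projective A (LinearMap.range e) :=
  Module.Projective.of_split (LinearMap.range e).subtype e.rangeRestrict
    (LinearMap.ext fun x => Subtype.ext ((LinearMap.IsIdempotentElem.mem_range_iff he).1 x.2))

lemma exists_isBaseChange_range {B M' : Type*} [CommRing B] [Algebra A B] [AddCommGroup M']
    [Module A M'] [Module B M'] [IsScalarTower A B M'] {f : M →ₗ[A] M'} (hf : IsBaseChange B f)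
    {e : Module.End A M} (he : IsIdempotentElem e) {e' : Module.End B M'}
    (hef : ∀ x, e' (f x) = f (e x)) :
    ∃ g : LinearMap.range e →ₗ[A] LinearMap.range e', IsBaseChange B g := by
  let g : LinearMap.range e →ₗ[A] LinearMap.range e' :=
    (e'.rangeRestrict.restrictScalars A).comp (f.comp (LinearMap.range e).subtype)
  have g_rangeRestrict (x : M) : g (e.rangeRestrict x) = e'.rangeRestrict (f x) :=
    Subtype.ext (by
      change e' (f (e x)) = e' (f x)
      rw [hef, hef, (LinearMap.IsIdempotentElem.mem_range_iff he).1 ⟨x, rfl⟩])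
  refine ⟨g, IsBaseChange.of_lift_unique _ fun Q _ _ _ _ φ => ?_⟩
  let := Module.addCommMonoidToAddCommGroup B (M := Q)
  let ψ := (hf.lift (φ.comp e.rangeRestrict)).comp (LinearMap.range e').subtype
  have ψ_g (x : LinearMap.range e) : ψ (g x) = φ x := by
    change hf.lift (φ.comp e.rangeRestrict) (e' (f x)) = φ x
    rw [hef, (LinearMap.IsIdempotentElem.mem_range_iff he).1 x.2, hf.lift_eq, LinearMap.comp_apply]
    exact congrArg φ (Subtype.ext ((LinearMap.IsIdempotentElem.mem_range_iff he).1 x.2))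
  refine ⟨ψ, LinearMap.ext ψ_g, fun ψ' hψ' => ?_⟩
  have : ψ'.comp e'.rangeRestrict = ψ.comp e'.rangeRestrict := hf.algHom_ext _ _ fun x => by
    rw [LinearMap.comp_apply, LinearMap.comp_apply, ← g_rangeRestrict, ψ_g]
    exact DFunLike.congr_fun hψ' _
  exact LinearMap.ext fun ⟨_, y, hy⟩ => hy ▸ DFunLike.congr_fun this y

lemma rankAtStalk_range_eq_finrank [Module.Projective A M] {e : Module.End A M}
    (he : IsIdempotentElem e) [Module.Finite A (LinearMap.range e)] (p : PrimeSpectrum A)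
    {M' : Type*} [AddCommGroup M'] [Module A M'] [Module p.asIdeal.ResidueField M']
    [IsScalarTower A p.asIdeal.ResidueField M'] {f : M →ₗ[A] M'}
    (hf : IsBaseChange p.asIdeal.ResidueField f) {e' : Module.End p.asIdeal.ResidueField M'}
    (hef : ∀ x, e' (f x) = f (e x)) :
    Module.rankAtStalk (LinearMap.range e) p =
      Module.finrank p.asIdeal.ResidueField (LinearMap.range e') := by
  have := projective_range_of_isIdempotentElem he
  obtain ⟨g, hg⟩ := exists_isBaseChange_range hf he hef
  rw [Module.rankAtStalk_eq, hg.equiv.finrank_eq]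

end Idempotents

section IdempotentMatrices

variable {ι A : Type*} [Fintype ι] [CommRing A] {E : Matrix ι ι A}

lemma isIdempotentElem_matrix_map {B : Type*} [CommRing B] (f : A →+* B)
    (hE : IsIdempotentElem E) : IsIdempotentElem (E.map f) := by
  rw [IsIdempotentElem, ← Matrix.map_mul, hE.eq]

lemma isIdempotentElem_vecMulLinear (hE : IsIdempotentElem E) :
    IsIdempotentElem (E.vecMulLinear : Module.End A (ι → A)) :=
  LinearMap.ext fun v => by
    simp only [Module.End.mul_apply, Matrix.vecMulLinear_apply, Matrix.vecMul_vecMul, hE.eq]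

lemma ker_vecMulLinear_eq_range [DecidableEq ι] (hE : IsIdempotentElem E) :
    LinearMap.ker E.vecMulLinear = LinearMap.range (1 - E).vecMulLinear := by
  have : (1 - E).vecMulLinear = 1 - E.vecMulLinear := LinearMap.ext fun v => by
    simp only [Matrix.vecMulLinear_apply, Matrix.vecMul_sub, Matrix.vecMul_one,
      LinearMap.sub_apply, Module.End.one_apply]
  rw [this, LinearMap.IsIdempotentElem.ker_eq_range_one_sub (isIdempotentElem_vecMulLinear hE)]

lemma exists_isIdempotentElem_eq_ker_vecMulLinear (V : Submodule A (ι → A))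
    [Module.Projective A ((ι → A) ⧸ V)] :
    ∃ E : Matrix ι ι A, IsIdempotentElem E ∧ V = LinearMap.ker E.vecMulLinear := by
  classical
  obtain ⟨σ, hσ⟩ := Module.projective_lifting_property V.mkQ LinearMap.id V.mkQ_surjective
  have mkQ_σ (x : (ι → A) ⧸ V) : V.mkQ (σ x) = x := DFunLike.congr_fun hσ x
  let E := LinearMap.toMatrixRight' (σ.comp V.mkQ)
  have vecMul_E (v : ι → A) : v ᵥ* E = σ (V.mkQ v) := by
    rw [← Matrix.toLinearMapRight'_apply]
    exact DFunLike.congr_fun (LinearMap.toMatrixRight'.symm_apply_apply _) v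
  refine ⟨E, Matrix.ext_of_single_vecMul fun i => ?_, Submodule.ext fun v => ?_⟩
  · rw [← Matrix.vecMul_vecMul, vecMul_E, vecMul_E, mkQ_σ]
  · rw [LinearMap.mem_ker, Matrix.vecMulLinear_apply, vecMul_E]
    refine ⟨fun hv => ?_, fun hv => ?_⟩
    · rw [V.mkQ_apply, (Submodule.Quotient.mk_eq_zero V).2 hv, map_zero]
    · rw [← Submodule.Quotient.mk_eq_zero, ← V.mkQ_apply, ← mkQ_σ (V.mkQ v), hv, map_zero]

lemma finrank_range_vecMulLinear {K : Type*} [Field K] (M : Matrix ι ι K) :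
    Module.finrank K (LinearMap.range M.vecMulLinear) = M.rank := by
  rw [range_vecMulLinear, Matrix.rank_eq_finrank_span_row]

lemma isLocallyFreeOfRank_quotient_ker_vecMulLinear_iff {ι : Type} [Fintype ι]
    {A : Type u} [CommRing A] {E : Matrix ι ι A} (hE : IsIdempotentElem E) (n : ℕ) :
    IsLocallyFreeOfRank A ((ι → A) ⧸ LinearMap.ker E.vecMulLinear) n ↔
      ∀ p : PrimeSpectrum A, (E.map (algebraMap A p.asIdeal.ResidueField)).rank = n := by
  have hE' := isIdempotentElem_vecMulLinear hE
  have := projective_range_of_isIdempotentElem hE'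
  have rankAtStalk_eq (p : PrimeSpectrum A) : Module.rankAtStalk (LinearMap.range E.vecMulLinear) p
      = (E.map (algebraMap A p.asIdeal.ResidueField)).rank :=
    (rankAtStalk_range_eq_finrank hE' p
      ((IsBaseChange.linearMap A p.asIdeal.ResidueField).finitePow ι)
      (e' := (E.map (algebraMap A p.asIdeal.ResidueField)).vecMulLinear) fun v =>
        funext fun j => (RingHom.map_vecMul _ E v j).symm).trans (finrank_range_vecMulLinear _)
  let quotEquiv := E.vecMulLinear.quotKerEquivRange
  exact ⟨fun h p => rankAtStalk_eq p ▸ (h.of_equiv quotEquiv).2.2 p, fun h =>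
    IsLocallyFreeOfRank.of_equiv ⟨inferInstance, this, fun p => (rankAtStalk_eq p).trans (h p)⟩
      quotEquiv.symm⟩

lemma exists_mul_eq_and_mul_eq_one {K : Type*} [Field K] {E : Matrix ι ι K}
    (hE : IsIdempotentElem E) : ∃ (G : Matrix ι (Fin E.rank) K) (F : Matrix (Fin E.rank) ι K),
      G * F = E ∧ F * G = 1 := by
  classical
  have hE' := isIdempotentElem_vecMulLinear hE
  let b : LinearMap.range E.vecMulLinear ≃ₗ[K] (Fin E.rank → K) :=
    LinearEquiv.ofFinrankEq _ _ (by rw [finrank_range_vecMulLinear, Module.finrank_fin_fun])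
  let γ := b.toLinearMap.comp E.vecMulLinear.rangeRestrict
  let φ := (LinearMap.range E.vecMulLinear).subtype.comp b.symm.toLinearMap
  have φ_comp_γ : φ.comp γ = E.toLinearMapRight' := LinearMap.ext fun v =>
    congrArg Subtype.val (b.symm_apply_apply (E.vecMulLinear.rangeRestrict v))
  have γ_comp_φ : γ.comp φ = LinearMap.id := LinearMap.ext fun v =>
    (congrArg b (Subtype.ext ((LinearMap.IsIdempotentElem.mem_range_iff hE').1
      (b.symm v).2))).trans (b.apply_symm_apply v)
  refine ⟨γ.toMatrixRight', φ.toMatrixRight', ?_, ?_⟩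
  · rw [← LinearMap.toMatrixRight'_comp, φ_comp_γ, LinearEquiv.apply_symm_apply]
  · rw [← LinearMap.toMatrixRight'_comp, γ_comp_φ, LinearMap.toMatrixRight'_id]

end IdempotentMatrices

/-! ### Ideals generated by linear forms -/

section FormIdeal

variable {ι A : Type*} [Fintype ι] [CommRing A]

/-- The ideal generated by the linear forms with coefficient vectors in `V`. Its quotient is the
symmetric algebra of `A^ι / V`. -/
noncomputable def formIdeal (V : Submodule A (ι → A)) : Ideal (MvPolynomial ι A) :=
  Ideal.span (linForm '' V)

lemma linForm_mem_formIdeal {V : Submodule A (ι → A)} {v : ι → A} (hv : v ∈ V) :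
    linForm v ∈ formIdeal V :=
  Ideal.subset_span ⟨v, hv, rfl⟩

lemma formIdeal_ker_vecMulLinear {E : Matrix ι ι A} (hE : IsIdempotentElem E) :
    formIdeal (LinearMap.ker E.vecMulLinear) = RingHom.ker (linSubst E) := by
  classical
  refine le_antisymm (Ideal.span_le.2 ?_) fun p hp => ?_
  · rintro _ ⟨v, hv, rfl⟩
    rw [SetLike.mem_coe, RingHom.mem_ker, linSubst_linForm, ← Matrix.vecMulLinear_apply,
      LinearMap.mem_ker.1 hv, map_zero]
  · suffices (Ideal.Quotient.mkₐ A (formIdeal (LinearMap.ker E.vecMulLinear))).comp (linSubst E) =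
        Ideal.Quotient.mkₐ A _ by
      rw [← Ideal.Quotient.eq_zero_iff_mem, ← Ideal.Quotient.mkₐ_eq_mk A, ← this,
        AlgHom.comp_apply, (RingHom.mem_ker).1 hp, map_zero]
    refine algHom_ext fun j => Ideal.Quotient.eq.2 ?_
    rw [← linForm_single, AlgHom.coe_toRingHom, linSubst_linForm, ← map_sub]
    refine linForm_mem_formIdeal ?_
    rw [LinearMap.mem_ker, map_sub, Matrix.vecMulLinear_apply, Matrix.vecMulLinear_apply,
      Matrix.vecMul_vecMul, hE.eq, sub_self]

/-- The graded pieces of the image of an idempotent linear substitution. -/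
noncomputable def linSubstComponent (E : Matrix ι ι A) (d : ℕ) :
    Module.End A (MvPolynomial ι A) :=
  (linSubst E).toLinearMap.comp (homogeneousComponent d)

lemma range_linSubstComponent (E : Matrix ι ι A) (d : ℕ) :
    LinearMap.range (linSubstComponent E d) =
      (homogeneousSubmodule ι A d).map (linSubst E).toLinearMap := by
  rw [linSubstComponent, LinearMap.range_comp]
  congr 1
  refine le_antisymm ?_ fun p hp => ⟨p, ?_⟩
  · rintro _ ⟨p, rfl⟩
    exact homogeneousComponent_isHomogeneous d p
  · rw [homogeneousComponent_of_mem hp, if_pos rfl]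

lemma isIdempotentElem_linSubstComponent {E : Matrix ι ι A} (hE : IsIdempotentElem E) (d : ℕ) :
    IsIdempotentElem (linSubstComponent E d) :=
  LinearMap.ext fun p => by
    have hom := isHomogeneous_linSubst E (homogeneousComponent_isHomogeneous d p)
    simp only [Module.End.mul_apply, linSubstComponent, LinearMap.comp_apply,
      AlgHom.toLinearMap_apply]
    rw [homogeneousComponent_of_mem hom, if_pos rfl, linSubst_linSubst, hE.eq]

lemma map_linSubstComponent {B : Type*} [CommRing B] (f : A →+* B) (E : Matrix ι ι A) (d : ℕ)
    (p : MvPolynomial ι A) :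
    linSubstComponent (E.map f) d (map f p) = map f (linSubstComponent E d p) := by
  simp only [linSubstComponent, LinearMap.comp_apply, AlgHom.toLinearMap_apply, map_linSubst]
  congr 1
  ext m
  simp only [coeff_homogeneousComponent, coeff_map, apply_ite f, map_zero]

/-- The graded pieces of the quotient by the kernel of `φ` are their images under `φ`. -/
noncomputable def gradedPieceKerEquiv {B : Type*} [CommRing B] [Algebra A B]
    (φ : MvPolynomial ι A →ₐ[A] B) (d : ℕ) :
    gradedPiece (RingHom.ker φ) d ≃ₗ[A] (homogeneousSubmodule ι A d).map φ.toLinearMap :=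
  (Submodule.equivMapOfInjective (Ideal.kerLiftAlg φ).toLinearMap
    (Ideal.kerLiftAlg_injective φ) _).trans
    (LinearEquiv.ofEq _ _ (Submodule.map_comp _ _ _).symm)

lemma finrank_homogeneousSubmodule (K : Type*) [Field K] (d : ℕ) :
    Module.finrank K (homogeneousSubmodule ι K d) =
      (Fintype.card ι).multichoose d := by
  classical
  let e : {m : ι →₀ ℕ | m.degree = d} ≃ Sym ι d := (Sym.equivNatSum ι d).symm
  rw [homogeneousSubmodule_eq_finsupp_supported,
    ((AddMonoidAlgebra.supportedEquivFinsupp (R := K) (S := K) _).trans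
      (Finsupp.domLCongr e)).finrank_eq, Module.finrank_finsupp_self, ← Nat.card_eq_fintype_card,
    Sym.natCard_sym_eq_multichoose, Nat.card_eq_fintype_card]

lemma finrank_range_linSubstComponent {K : Type*} [Field K] {E : Matrix ι ι K}
    (hE : IsIdempotentElem E) (d : ℕ) :
    Module.finrank K (LinearMap.range (linSubstComponent E d)) = E.rank.multichoose d := by
  obtain ⟨G, F, hGF, hFG⟩ := exists_mul_eq_and_mul_eq_one hE
  have linSubst_F_injective : Function.Injective (linSubst F) :=
    Function.LeftInverse.injective (g := linSubst G) fun p => by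
      rw [linSubst_linSubst, hFG, linSubst_one]
  have F_mul_E : F * E = F := (congrArg (F * ·) hGF.symm).trans (by
    rw [← Matrix.mul_assoc, hFG, Matrix.one_mul])
  have range_eq : LinearMap.range (linSubstComponent E d) =
      (homogeneousSubmodule (Fin E.rank) K d).map (linSubst F).toLinearMap := by
    rw [range_linSubstComponent]
    refine le_antisymm ?_ ?_
    · rintro _ ⟨p, hp, rfl⟩
      refine ⟨linSubst G p, isHomogeneous_linSubst G hp, ?_⟩
      rw [AlgHom.toLinearMap_apply, AlgHom.toLinearMap_apply, linSubst_linSubst, hGF]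
    · rintro _ ⟨p, hp, rfl⟩
      refine ⟨linSubst F p, isHomogeneous_linSubst F hp, ?_⟩
      rw [AlgHom.toLinearMap_apply, AlgHom.toLinearMap_apply, linSubst_linSubst, F_mul_E]
  rw [range_eq, ← (Submodule.equivMapOfInjective (linSubst F).toLinearMap linSubst_F_injective
    _).finrank_eq, finrank_homogeneousSubmodule, Fintype.card_fin]

end FormIdeal

section Pushout

attribute [local instance] MvPolynomial.algebraMvPolynomial

lemma isBaseChange_mvPolynomial (ι A B : Type*) [CommRing A] [CommRing B] [Algebra A B] :
    IsBaseChange B (mapAlgHom (σ := ι) (Algebra.ofId A B)).toLinearMap := by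
  exact (inferInstance : Algebra.IsPushout A B (MvPolynomial ι A) (MvPolynomial ι B)).out

end Pushout

lemma isLocallyFreeOfRank_gradedPiece_formIdeal {ι : Type} [Fintype ι] {A : Type u} [CommRing A]
    {V : Submodule A (ι → A)} {n : ℕ} (hV : IsLocallyFreeOfRank A ((ι → A) ⧸ V) n) (d : ℕ) :
    IsLocallyFreeOfRank A (gradedPiece (formIdeal V) d) (n.multichoose d) := by
  have := hV.2.1
  obtain ⟨E, hE, rfl⟩ := exists_isIdempotentElem_eq_ker_vecMulLinear V
  rw [isLocallyFreeOfRank_quotient_ker_vecMulLinear_iff hE] at hV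
  have hEd := isIdempotentElem_linSubstComponent hE d
  have finite_range : Module.Finite A (LinearMap.range (linSubstComponent E d)) := by
    rw [range_linSubstComponent]
    exact Module.Finite.iff_fg.2 ((homogeneousSubmodule_fg ι A d).map _)
  have rank_range : IsLocallyFreeOfRank A (LinearMap.range (linSubstComponent E d))
      (n.multichoose d) := by
    refine ⟨finite_range, projective_range_of_isIdempotentElem hEd, fun p => ?_⟩
    rw [rankAtStalk_range_eq_finrank hEd p (isBaseChange_mvPolynomial ι A p.asIdeal.ResidueField)
      (map_linSubstComponent (algebraMap A p.asIdeal.ResidueField) E d),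
      finrank_range_linSubstComponent (isIdempotentElem_matrix_map _ hE), hV p]
  rw [formIdeal_ker_vecMulLinear hE]
  rw [range_linSubstComponent] at rank_range
  exact rank_range.of_equiv (gradedPieceKerEquiv (linSubst E) d).symm

/-! ### Orthogonal complements and base change -/

section BaseChange

variable {A B : Type u} [CommRing A] [CommRing B] (f : A →+* B)

lemma baseChange_range_vecMulLinear (M : Matrix (Fin 6) (Fin 6) A) :
    baseChange f (LinearMap.range M.vecMulLinear) = LinearMap.range (M.map f).vecMulLinear := by
  refine le_antisymm (Submodule.span_le.2 ?_) ?_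
  · rintro _ ⟨_, ⟨v, rfl⟩, rfl⟩
    exact ⟨fun j => f (v j), funext fun j => (RingHom.map_vecMul f M v j).symm⟩
  · rw [range_vecMulLinear, Submodule.span_le]
    rintro _ ⟨i, rfl⟩
    exact Submodule.subset_span ⟨M i, ⟨Pi.single i 1, Matrix.single_one_vecMul i M⟩, rfl⟩

lemma baseChange_ker_vecMulLinear {E : Matrix (Fin 6) (Fin 6) A} (hE : IsIdempotentElem E) :
    baseChange f (LinearMap.ker E.vecMulLinear) = LinearMap.ker (E.map f).vecMulLinear := by
  rw [ker_vecMulLinear_eq_range hE, baseChange_range_vecMulLinear,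
    ker_vecMulLinear_eq_range (isIdempotentElem_matrix_map f hE), Matrix.map_sub f (map_sub f),
    Matrix.map_one f (map_zero f) (map_one f)]

lemma IsLocallyFreeOfRank.of_isBaseChange {M M' : Type u} [Algebra A B] [AddCommGroup M]
    [Module A M] [AddCommGroup M'] [Module A M'] [Module B M'] [IsScalarTower A B M'] {n : ℕ}
    (h : IsLocallyFreeOfRank A M n) {g : M →ₗ[A] M'} (hg : IsBaseChange B g) :
    IsLocallyFreeOfRank B M' n := by
  obtain ⟨_, _, hrank⟩ := h
  exact ⟨Module.Finite.equiv hg.equiv, Module.Projective.of_equiv hg.equiv,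
    fun p => by rw [Module.rankAtStalk_isBaseChange hg, hrank]⟩

lemma baseChange_mem_planes {U : Submodule A (Fin 6 → A)} (hU : U ∈ planes A) :
    baseChange f U ∈ planes B := by
  algebraize [f]
  have := hU.2.1
  obtain ⟨E, hE, rfl⟩ := exists_isIdempotentElem_eq_ker_vecMulLinear U
  obtain ⟨g, hg⟩ := exists_isBaseChange_range
    ((IsBaseChange.linearMap A B).finitePow (Fin 6)) (isIdempotentElem_vecMulLinear hE)
    (e' := (E.map f).vecMulLinear) fun v => funext fun j => (RingHom.map_vecMul f E v j).symm
  rw [baseChange_ker_vecMulLinear f hE]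
  exact ((hU.of_equiv E.vecMulLinear.quotKerEquivRange).of_isBaseChange hg).of_equiv
    (E.map f).vecMulLinear.quotKerEquivRange.symm

end BaseChange

section Orthogonal

variable {A : Type*} [CommRing A]

lemma matQ_mul_self (A : Type*) [CommRing A] : matQ A * matQ A = 1 := by
  ext i j
  fin_cases i <;> fin_cases j <;> simp [matQ, Matrix.mul_apply, Fin.sum_univ_succ]

lemma matQ_transpose (A : Type*) [CommRing A] : (matQ A)ᵀ = matQ A := by
  ext i j
  fin_cases i <;> fin_cases j <;> rfl

lemma matQ_map {B : Type*} [CommRing B] (f : A →+* B) : (matQ A).map f = matQ B := by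
  ext i j
  fin_cases i <;> fin_cases j <;> simp [matQ]

lemma formQ_apply (v w : Fin 6 → A) : formQ A v w = v ⬝ᵥ matQ A *ᵥ w :=
  Matrix.toBilin'_apply' _ _ _

/-- The idempotent whose kernel is the orthogonal complement of the kernel of the idempotent
`E`. -/
def orthIdempotent (E : Matrix (Fin 6) (Fin 6) A) : Matrix (Fin 6) (Fin 6) A :=
  matQ A * (1 - E)ᵀ * matQ A

lemma orthIdempotent_orthIdempotent (E : Matrix (Fin 6) (Fin 6) A) :
    orthIdempotent (orthIdempotent E) = E := by
  simp only [orthIdempotent, Matrix.transpose_sub, Matrix.transpose_mul, Matrix.transpose_one,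
    matQ_transpose, mul_sub, sub_mul, mul_one, matQ_mul_self, Matrix.transpose_transpose,
    mul_assoc, sub_sub_cancel]
  rw [← mul_assoc, matQ_mul_self, one_mul]

lemma isIdempotentElem_orthIdempotent {E : Matrix (Fin 6) (Fin 6) A} (hE : IsIdempotentElem E) :
    IsIdempotentElem (orthIdempotent E) := by
  have hE' : (1 - E)ᵀ * (1 - E)ᵀ = (1 - E)ᵀ := by rw [← Matrix.transpose_mul, hE.one_sub.eq]
  calc matQ A * (1 - E)ᵀ * matQ A * (matQ A * (1 - E)ᵀ * matQ A)
    _ = matQ A * ((1 - E)ᵀ * (matQ A * matQ A) * (1 - E)ᵀ) * matQ A := by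
      simp only [mul_assoc]
    _ = orthIdempotent E := by rw [matQ_mul_self, mul_one, hE', orthIdempotent]

lemma orthIdempotent_map {B : Type*} [CommRing B] (f : A →+* B) (E : Matrix (Fin 6) (Fin 6) A) :
    (orthIdempotent E).map f = orthIdempotent (E.map f) := by
  rw [orthIdempotent, orthIdempotent, Matrix.map_mul, Matrix.map_mul, matQ_map,
    Matrix.transpose_map, Matrix.map_sub f (map_sub f), Matrix.map_one f (map_zero f) (map_one f)]

lemma rank_orthIdempotent {K : Type*} [Field K] {E : Matrix (Fin 6) (Fin 6) K}
    (hE : IsIdempotentElem E) : (orthIdempotent E).rank + E.rank = 6 := by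
  have hQ : IsUnit (matQ K).det :=
    (Matrix.isUnit_iff_isUnit_det _).1 (.of_mul_eq_one _ (matQ_mul_self K))
  have rank_one_sub : (1 - E).rank = Module.finrank K (LinearMap.ker E.vecMulLinear) := by
    rw [ker_vecMulLinear_eq_range hE, finrank_range_vecMulLinear]
  rw [orthIdempotent, Matrix.rank_mul_eq_left_of_isUnit_det _ _ hQ,
    Matrix.rank_mul_eq_right_of_isUnit_det _ _ hQ, Matrix.rank_transpose, rank_one_sub,
    ← finrank_range_vecMulLinear, add_comm, LinearMap.finrank_range_add_finrank_ker,
    Module.finrank_fin_fun]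

lemma orthogonal_ker_vecMulLinear {E : Matrix (Fin 6) (Fin 6) A} (hE : IsIdempotentElem E) :
    (formQ A).orthogonal (LinearMap.ker E.vecMulLinear) =
      LinearMap.ker (orthIdempotent E).vecMulLinear := by
  ext v
  have formQ_eq (w : Fin 6 → A) :
      formQ A (w ᵥ* (1 - E)) v = w ⬝ᵥ (v ᵥ* (matQ A * (1 - E)ᵀ)) := by
    rw [formQ_apply, ← Matrix.dotProduct_mulVec, ← Matrix.vecMul_vecMul,
      Matrix.vecMul_transpose, ← matQ_transpose, Matrix.vecMul_transpose, matQ_transpose]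
  rw [ker_vecMulLinear_eq_range hE, LinearMap.mem_ker, Matrix.vecMulLinear_apply, orthIdempotent,
    ← Matrix.vecMul_vecMul]
  refine ⟨fun hv => ?_, fun hv => ?_⟩
  · have : v ᵥ* (matQ A * (1 - E)ᵀ) = 0 := dotProduct_eq_zero _ fun w => by
      rw [dotProduct_comm, ← formQ_eq]
      exact hv _ ⟨w, rfl⟩
    rw [this, Matrix.zero_vecMul]
  · have : v ᵥ* (matQ A * (1 - E)ᵀ) = 0 :=
      calc v ᵥ* (matQ A * (1 - E)ᵀ)
        _ = v ᵥ* (matQ A * (1 - E)ᵀ) ᵥ* matQ A ᵥ* matQ A := by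
          rw [Matrix.vecMul_vecMul _ (matQ A), matQ_mul_self, Matrix.vecMul_one]
        _ = 0 := by rw [hv, Matrix.zero_vecMul]
    rintro _ ⟨w, rfl⟩
    exact (formQ_eq w).trans (by rw [this, dotProduct_zero])

lemma orthogonal_orthogonal (U : Submodule A (Fin 6 → A))
    [Module.Projective A ((Fin 6 → A) ⧸ U)] :
    (formQ A).orthogonal ((formQ A).orthogonal U) = U := by
  obtain ⟨E, hE, rfl⟩ := exists_isIdempotentElem_eq_ker_vecMulLinear U
  rw [orthogonal_ker_vecMulLinear hE,
    orthogonal_ker_vecMulLinear (isIdempotentElem_orthIdempotent hE),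
    orthIdempotent_orthIdempotent]

end Orthogonal

section PlanesOrthogonal

variable {A B : Type u} [CommRing A] [CommRing B]

lemma isLocallyFreeOfRank_quotient_orthogonal {U : Submodule A (Fin 6 → A)} {n m : ℕ}
    (h : IsLocallyFreeOfRank A ((Fin 6 → A) ⧸ U) n) (hnm : m + n = 6) :
    IsLocallyFreeOfRank A ((Fin 6 → A) ⧸ (formQ A).orthogonal U) m := by
  have := h.2.1
  obtain ⟨E, hE, rfl⟩ := exists_isIdempotentElem_eq_ker_vecMulLinear U
  rw [isLocallyFreeOfRank_quotient_ker_vecMulLinear_iff hE] at h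
  rw [orthogonal_ker_vecMulLinear hE, isLocallyFreeOfRank_quotient_ker_vecMulLinear_iff
    (isIdempotentElem_orthIdempotent hE)]
  intro p
  have := rank_orthIdempotent
    (isIdempotentElem_matrix_map (algebraMap A p.asIdeal.ResidueField) hE)
  rw [orthIdempotent_map]
  have := h p
  omega

lemma orthogonal_baseChange (f : A →+* B) (U : Submodule A (Fin 6 → A))
    [Module.Projective A ((Fin 6 → A) ⧸ U)] :
    (formQ B).orthogonal (baseChange f U) = baseChange f ((formQ A).orthogonal U) := by
  obtain ⟨E, hE, rfl⟩ := exists_isIdempotentElem_eq_ker_vecMulLinear U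
  rw [baseChange_ker_vecMulLinear f hE, orthogonal_ker_vecMulLinear hE,
    baseChange_ker_vecMulLinear f (isIdempotentElem_orthIdempotent hE), orthIdempotent_map,
    orthogonal_ker_vecMulLinear (isIdempotentElem_matrix_map f hE)]

end PlanesOrthogonal

/-! ### Fixed points of the invariant Hilbert scheme -/

section RankOneIdeal

variable {κ ι A : Type*} [Fintype ι] [CommRing A]

lemma linForm_mem_formIdeal_iff {V : Submodule A (ι → A)} {v : ι → A} :
    linForm v ∈ formIdeal V ↔ v ∈ V := by
  classical
  refine ⟨fun hv => ?_, linForm_mem_formIdeal⟩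
  let φ : MvPolynomial ι A →ₐ[A] TrivSqZeroExt A ((ι → A) ⧸ V) :=
    aeval fun j => TrivSqZeroExt.inr (V.mkQ (Pi.single j 1))
  have φ_linForm (w : ι → A) : φ (linForm w) = TrivSqZeroExt.inr (V.mkQ w) := by
    simp only [φ, aeval_linForm]
    conv_rhs => rw [pi_eq_sum_univ' w]
    simp only [map_sum, map_smul, ← TrivSqZeroExt.inrHom_apply A]
  have formIdeal_le_ker : formIdeal V ≤ RingHom.ker φ := by
    refine Ideal.span_le.2 ?_
    rintro _ ⟨w, hw, rfl⟩
    rw [SetLike.mem_coe, RingHom.mem_ker, φ_linForm, Submodule.mkQ_apply,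
      (Submodule.Quotient.mk_eq_zero V).2 hw, TrivSqZeroExt.inr_zero]
  have := (φ_linForm v).symm.trans (formIdeal_le_ker hv)
  exact (Submodule.Quotient.mk_eq_zero V).1 (TrivSqZeroExt.inr_injective this)

variable (κ) in
/-- The ideal of the matrices of rank at most one all of whose rows vanish on `V`. -/
noncomputable def rankOneIdeal (V : Submodule A (ι → A)) : Ideal (MvPolynomial (κ × ι) A) :=
  (⨆ k, (formIdeal V).map (rename (Prod.mk k))) ⊔ minorIdeal κ ι A

lemma rename_linForm_mem_rankOneIdeal {V : Submodule A (ι → A)} {v : ι → A} (hv : v ∈ V) (k : κ) :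
    rename (Prod.mk k) (linForm v) ∈ rankOneIdeal κ V :=
  Ideal.mem_sup_left (Ideal.mem_iSup_of_mem k
    (Ideal.mem_map_of_mem _ (linForm_mem_formIdeal hv)))

lemma rankOneIdeal_le_iff {V : Submodule A (ι → A)} {I : Ideal (MvPolynomial (κ × ι) A)} :
    rankOneIdeal κ V ≤ I ↔
      (∀ k, ∀ v ∈ V, rename (Prod.mk k) (linForm v) ∈ I) ∧ minorIdeal κ ι A ≤ I := by
  simp only [rankOneIdeal, sup_le_iff, iSup_le_iff, Ideal.map_le_iff_le_comap, formIdeal,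
    Ideal.span_le, Set.image_subset_iff]
  rfl

lemma rowIdeal_rankOneIdeal (V : Submodule A (ι → A)) (k : κ) :
    rowIdeal k (rankOneIdeal κ V) = formIdeal V := by
  classical
  let restrictRow : MvPolynomial (κ × ι) A →ₐ[A] MvPolynomial ι A :=
    aeval fun p => if p.1 = k then X p.2 else 0
  have restrictRow_rename (l : κ) (p : MvPolynomial ι A) : restrictRow (rename (Prod.mk l) p) =
      aeval (fun j => if l = k then X j else (0 : MvPolynomial ι A)) p :=
    aeval_rename _ _ _
  have rankOneIdeal_le : rankOneIdeal κ V ≤ (formIdeal V).comap restrictRow := by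
    refine rankOneIdeal_le_iff.2 ⟨fun l v hv => ?_, Ideal.span_le.2 ?_⟩
    · rw [Ideal.mem_comap, restrictRow_rename]
      obtain rfl | hl := eq_or_ne l k
      · simpa using linForm_mem_formIdeal hv
      · simp only [if_neg hl, aeval_linForm, smul_zero, Finset.sum_const_zero, zero_mem]
    · rintro _ ⟨l, l', i, j, rfl⟩
      have : restrictRow (X (l, i) * X (l', j) - X (l, j) * X (l', i)) = 0 := by
        by_cases hl : l = k <;> by_cases hl' : l' = k <;> simp [restrictRow, hl, hl', mul_comm]
      rw [SetLike.mem_coe, Ideal.mem_comap, this]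
      exact zero_mem _
  refine le_antisymm (fun p hp => ?_) (Ideal.span_le.2 ?_)
  · have := rankOneIdeal_le hp
    simpa only [Ideal.mem_comap, restrictRow_rename, if_true, aeval_X_left_apply] using this
  · rintro _ ⟨v, hv, rfl⟩
    exact rename_linForm_mem_rankOneIdeal hv k

lemma rankOneIdeal_injective [Nonempty κ] :
    Function.Injective (rankOneIdeal κ : Submodule A (ι → A) → _) := by
  intro V V' h
  obtain ⟨k⟩ := ‹Nonempty κ›
  have := congrArg (rowIdeal k) h
  rw [rowIdeal_rankOneIdeal, rowIdeal_rankOneIdeal] at this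
  ext v
  rw [← linForm_mem_formIdeal_iff, this, linForm_mem_formIdeal_iff]

variable [Fintype κ]

lemma coaction_rename_linForm (v : ι → A) (k : κ) :
    coaction κ ι A (rename (Prod.mk k) (linForm v)) =
      ∑ l, X (k, l) * C (rename (Prod.mk l) (linForm v)) := by
  have linForm_eq : linForm v = ∑ j, C (v j) * X j := by
    simp only [linForm_apply, smul_eq_C_mul]
  have coaction_C (a : A) : coaction κ ι A (C a) = C (C a) := algHom_C _ a
  simp only [linForm_eq, map_sum, map_mul, rename_C, rename_X, coaction_C, coaction_X,
    Finset.mul_sum]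
  rw [Finset.sum_comm]
  exact Finset.sum_congr rfl fun l _ => Finset.sum_congr rfl fun j _ => mul_left_comm _ _ _

lemma isMatStable_rankOneIdeal (V : Submodule A (ι → A)) : IsMatStable (rankOneIdeal κ V) := by
  refine rankOneIdeal_le_iff.2 ⟨fun k v hv => ?_, ?_⟩
  · rw [Ideal.mem_comap, coaction_rename_linForm]
    exact sum_mem fun l _ => Ideal.mul_mem_left _ _
      (Ideal.mem_map_of_mem C (rename_linForm_mem_rankOneIdeal hv l))
  · exact isMatStable_minorIdeal.trans (Ideal.comap_mono (Ideal.map_mono le_sup_right))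

end RankOneIdeal

section Determined

variable {ι : Type} {A : Type u} [CommRing A]

lemma mem_of_isLocallyFreeOfRank_gradedPiece {N N' : Ideal (MvPolynomial ι A)} (hle : N' ≤ N)
    {d n : ℕ} (h : IsLocallyFreeOfRank A (gradedPiece N d) n)
    (h' : IsLocallyFreeOfRank A (gradedPiece N' d) n) {c : MvPolynomial ι A}
    (hc : c.IsHomogeneous d) (hcN : c ∈ N) : c ∈ N' := by
  have maps_gradedPiece : ∀ x ∈ gradedPiece N' d,
      (Ideal.Quotient.factorₐ A hle).toLinearMap x ∈ gradedPiece N d := by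
    rintro _ ⟨p, hp, rfl⟩
    exact ⟨p, hp, rfl⟩
  let φ : gradedPiece N' d →ₗ[A] gradedPiece N d :=
    (Ideal.Quotient.factorₐ A hle).toLinearMap.restrict maps_gradedPiece
  have φ_surjective : Function.Surjective φ := by
    rintro ⟨_, p, hp, rfl⟩
    exact ⟨⟨_, p, hp, rfl⟩, rfl⟩
  have φ_mk_eq_zero : φ ⟨Ideal.Quotient.mk N' c, c, hc, rfl⟩ = 0 :=
    Subtype.ext (Ideal.Quotient.eq_zero_iff_mem.2 hcN)
  have := (h'.bijective_of_surjective h φ_surjective).1 (φ_mk_eq_zero.trans (map_zero φ).symm)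
  exact Ideal.Quotient.eq_zero_iff_mem.1 (congrArg Subtype.val this)

variable [Fintype ι]

/-- The degree one part of the quotient by `N`, in terms of the linear forms in `N`. -/
noncomputable def gradedPieceOneEquiv (N : Ideal (MvPolynomial ι A)) :
    ((ι → A) ⧸ (N.restrictScalars A).comap linForm) ≃ₗ[A] gradedPiece N 1 :=
  (Submodule.quotEquivOfEq _ _ (by
    ext v
    exact Ideal.Quotient.eq_zero_iff_mem.symm)).trans
  (((Ideal.Quotient.mkₐ A N).toLinearMap.comp linForm).quotKerEquivRange.trans
    (LinearEquiv.ofEq _ _ (by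
      rw [LinearMap.range_comp, gradedPiece, homogeneousSubmodule_one_eq_span_X,
        ← Fintype.range_linearCombination]
      rfl)))

lemma exists_rankOneIdeal_eq_of_isLocallyFreeOfRank (K : Type*) {κ : Type*} [Fintype κ] [Field K]
    [CharZero K] [Algebra K A] {I : Ideal (MvPolynomial (κ × ι) A)} (hI : IsMatStable I)
    (hm : minorIdeal κ ι A ≤ I) (k : κ) {n : ℕ}
    (hN : ∀ d, IsLocallyFreeOfRank A (gradedPiece (rowIdeal k I) d) (n.multichoose d)) :
    ∃ V : Submodule A (ι → A), IsLocallyFreeOfRank A ((ι → A) ⧸ V) n ∧ rankOneIdeal κ V = I := by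
  let V := ((rowIdeal k I).restrictScalars A).comap linForm
  have hV : IsLocallyFreeOfRank A ((ι → A) ⧸ V) n :=
    Nat.multichoose_one_right n ▸ (hN 1).of_equiv (gradedPieceOneEquiv _).symm
  have formIdeal_le : formIdeal V ≤ rowIdeal k I := Ideal.span_le.2 (Set.image_subset_iff.2 le_rfl)
  refine ⟨V, hV, ?_⟩
  rw [(isMatStable_rankOneIdeal V).eq_comap_segre K le_sup_right k, hI.eq_comap_segre K hm k,
    rowIdeal_rankOneIdeal]
  refine le_antisymm (Ideal.comap_mono (Ideal.map_mono formIdeal_le)) fun f hf => ?_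
  rw [Ideal.mem_comap, mem_map_C_iff] at hf ⊢
  exact fun m => mem_of_isLocallyFreeOfRank_gradedPiece formIdeal_le (hN m.degree)
    (isLocallyFreeOfRank_gradedPiece_formIdeal hV m.degree) (isHomogeneous_coeff_segre f m) (hf m)

end Determined

lemma rowSubst_minor {A : Type u} [CommRing A] (h : Matrix (Fin 2) (Fin 2) A) (i j : Fin 6) :
    rowSubst h (minor A i j) = C h.det * minor A i j := by
  simp only [minor_eq, Matrix.det_fin_two, map_sub, map_mul, rowSubst_X, Fin.sum_univ_two,
    smul_eq_C_mul]
  ring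

section Invariants

variable {A : Type u} [CommRing A] [Algebra ℂ A] {I : Ideal (CoordRing A)}

/-- The subalgebra of `SL₂`-invariants of `A[X] / I`. -/
noncomputable def invariants (I : Ideal (CoordRing A)) (hI : SlStable I) :
    Subalgebra A (CoordRing A ⧸ I) where
  carrier := {x | ∀ g, slActQuot I hI g x = x}
  mul_mem' hx hy g := by rw [map_mul, hx g, hy g]
  add_mem' hx hy g := by rw [map_add, hx g, hy g]
  algebraMap_mem' a g := AlgHom.commutes _ a

lemma binForm_zero_eq_C (p : BinForm 0) :
    (p : MvPolynomial (Fin 2) ℂ) = C (coeff 0 (p : MvPolynomial (Fin 2) ℂ)) :=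
  totalDegree_eq_zero_iff_eq_C.1 (Nat.le_zero.1 p.2.totalDegree_le)

lemma binRep_zero (g : SL(2, ℂ)) (p : BinForm 0) : binRep 0 g p = p :=
  Subtype.ext (by rw [coe_binRep, binForm_zero_eq_C p, linSubst, algHom_C, algebraMap_eq])

/-- The covariants of type `V_0` are the invariants. -/
noncomputable def covariantsZeroEquiv (hI : SlStable I) :
    covariants I hI 0 ≃ₗ[A] invariants I hI where
  toFun φ := ⟨φ.1 (highestWeightVector 0), fun g => by rw [← φ.2, binRep_zero]⟩
  map_add' φ ψ := rfl
  map_smul' a φ := rfl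
  invFun x := ⟨((LinearMap.toSpanSingleton ℂ (CoordRing A ⧸ I) x.1).comp (lcoeff ℂ 0)).comp
      (Submodule.subtype _), fun g p => by
    rw [binRep_zero]
    change _ = ((slActQuot I hI g).restrictScalars ℂ) (coeff 0 p.1 • x.1)
    rw [map_smul, AlgHom.restrictScalars_apply, x.2 g]
    rfl⟩
  left_inv φ := by
    refine Subtype.ext (LinearMap.ext fun p => ?_)
    change coeff 0 p.1 • φ.1 _ = φ.1 p
    rw [← map_smul]
    refine congrArg φ.1 (Subtype.ext ?_)
    rw [binForm_zero_eq_C p, coeff_C, if_pos rfl]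
    exact (smul_eq_C_mul _ _).trans (mul_one _)
  right_inv x := by
    refine Subtype.ext ?_
    change coeff 0 (X 0 ^ 0 : MvPolynomial (Fin 2) ℂ) • x.1 = x.1
    rw [pow_zero, coeff_zero_one, one_smul]

lemma exists_sub_C_mem (hI : SlStable I) (h0 : IsLocallyFreeOfRank A (covariants I hI 0) 1)
    {f : CoordRing A} (hf : ∀ g, slAct A g f = f) : ∃ a, f - C a ∈ I := by
  obtain ⟨_, _, hrank⟩ := h0.of_equiv (covariantsZeroEquiv hI)
  obtain ⟨a, ha⟩ := ((Module.algebraMap_bijective_iff_rankAtStalk (R := A)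
    (S := invariants I hI)).1 (_root_.funext hrank)).2
      ⟨Ideal.Quotient.mk I f, fun g => congrArg (Ideal.Quotient.mk I) (hf g)⟩
  exact ⟨a, Ideal.Quotient.eq.1 (congrArg Subtype.val ha).symm⟩

/-- Modulo `I` the minors are scalars, but scaling by `2` multiplies them by `4`. -/
lemma IsMatStable.minorIdeal_le (hI : IsMatStable I)
    (h0 : IsLocallyFreeOfRank A (covariants I hI.slStable 0) 1) :
    minorIdeal (Fin 2) (Fin 6) A ≤ I := by
  rw [minorIdeal_eq_span_minor, Ideal.span_le]
  rintro _ ⟨i, j, rfl⟩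
  have slAct_minor (g : SL(2, ℂ)) : slAct A g (minor A i j) = minor A i j := by
    rw [slAct_eq_rowSubst, rowSubst_minor, ← RingHom.mapMatrix_apply, ← RingHom.map_det,
      Matrix.SpecialLinearGroup.det_coe, map_one, map_one, one_mul]
  obtain ⟨a, ha⟩ := exists_sub_C_mem hI.slStable h0 slAct_minor
  have four_mul_minor_sub_mem : 4 * minor A i j - C a ∈ I := by
    have := hI.rowSubst_mem ((2 : A) • 1) ha
    rwa [map_sub, rowSubst_minor, algHom_C, algebraMap_eq, Matrix.det_smul, Matrix.det_one,
      Fintype.card_fin, mul_one, show (2 : A) ^ 2 = 4 by norm_num, map_ofNat] at this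
  have three_mul_minor_mem : 3 * minor A i j ∈ I := by
    have := I.sub_mem four_mul_minor_sub_mem ha
    ring_nf at this
    rwa [mul_comm] at this
  have isUnit_three : IsUnit (3 : CoordRing A) := by
    simpa only [map_ofNat] using
      (IsUnit.mk0 (3 : ℂ) three_ne_zero).map (algebraMap ℂ (CoordRing A))
  exact (I.unit_mul_mem_iff_mem isUnit_three).1 three_mul_minor_mem

end Invariants

lemma genMat_mulVec_C {A : Type u} [CommRing A] (v : Fin 6 → A) (k : Fin 2) :
    (genMat A *ᵥ fun j => C (v j)) k = rename (Prod.mk k) (linForm v) := by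
  simp only [linForm_apply, smul_eq_C_mul, map_sum, map_mul, rename_C, rename_X, mul_comm (C _)]
  rfl

lemma linIdeal_sup_minorIdeal {A : Type u} [CommRing A] (V : Submodule A (Fin 6 → A)) :
    linIdeal V ⊔ minorIdeal (Fin 2) (Fin 6) A = rankOneIdeal (Fin 2) V := by
  refine le_antisymm (sup_le (Ideal.span_le.2 ?_) le_sup_right) (rankOneIdeal_le_iff.2
    ⟨fun k v hv => Ideal.mem_sup_left (Ideal.subset_span ⟨v, hv, k, ?_⟩), le_sup_right⟩)
  · rintro _ ⟨v, hv, k, rfl⟩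
    exact genMat_mulVec_C v k ▸ rename_linForm_mem_rankOneIdeal hv k
  · exact (genMat_mulVec_C v k).symm

lemma planeIdeal_eq_rankOneIdeal {A : Type u} [CommRing A] (U : Submodule A (Fin 6 → A)) :
    planeIdeal U = rankOneIdeal (Fin 2) ((formQ A).orthogonal U) := by
  rw [planeIdeal, ← minorIdeal_eq_span_minor, linIdeal_sup_minorIdeal]

section FixedPoints

variable {A : Type u} [CommRing A] [Algebra ℂ A]

lemma mem_slHilbFixed_bot_iff {I : Ideal (CoordRing A)} :
    I ∈ slHilbFixed ⊥ A ↔ IsMatStable I ∧ minorIdeal (Fin 2) (Fin 6) A ≤ I ∧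
      ∀ d, IsLocallyFreeOfRank A (gradedPiece (rowIdeal 0 I) d) (d + 1) := by
  constructor
  · rintro ⟨⟨-, hs, hcov⟩, ht⟩
    have hI := isMatStable_iff.2 ⟨hs, ht⟩
    have hm := hI.minorIdeal_le (hcov 0)
    exact ⟨hI, hm, fun d => (hcov d).of_equiv (hI.covariantsEquiv hm d)⟩
  · rintro ⟨hI, hm, hN⟩
    exact ⟨⟨Ideal.map_bot.trans_le bot_le, hI.slStable,
      fun d => (hN d).of_equiv (hI.covariantsEquiv hm d).symm⟩, (isMatStable_iff.1 hI).2⟩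

lemma mem_slHilbFixed_bot_iff_exists {I : Ideal (CoordRing A)} :
    I ∈ slHilbFixed ⊥ A ↔ ∃ V : Submodule A (Fin 6 → A),
      IsLocallyFreeOfRank A ((Fin 6 → A) ⧸ V) 2 ∧ rankOneIdeal (Fin 2) V = I := by
  rw [mem_slHilbFixed_bot_iff]
  constructor
  · rintro ⟨hI, hm, hN⟩
    exact exists_rankOneIdeal_eq_of_isLocallyFreeOfRank ℂ hI hm 0 fun d =>
      Nat.multichoose_two d ▸ hN d
  · rintro ⟨V, hV, rfl⟩
    refine ⟨isMatStable_rankOneIdeal V, le_sup_right, fun d => ?_⟩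
    rw [rowIdeal_rankOneIdeal]
    exact Nat.multichoose_two d ▸ isLocallyFreeOfRank_gradedPiece_formIdeal hV d

lemma bijOn_planeIdeal (A : Type u) [CommRing A] [Algebra ℂ A] :
    Set.BijOn planeIdeal (planes A) (slHilbFixed ⊥ A) := by
  refine ⟨fun U hU => ?_, fun U hU U' hU' h => ?_, fun I hI => ?_⟩
  · exact mem_slHilbFixed_bot_iff_exists.2 ⟨_, isLocallyFreeOfRank_quotient_orthogonal hU rfl,
      (planeIdeal_eq_rankOneIdeal U).symm⟩
  · have := hU.2.1
    have := hU'.2.1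
    rw [planeIdeal_eq_rankOneIdeal, planeIdeal_eq_rankOneIdeal] at h
    rw [← orthogonal_orthogonal U, rankOneIdeal_injective h, orthogonal_orthogonal]
  · obtain ⟨V, hV, rfl⟩ := mem_slHilbFixed_bot_iff_exists.1 hI
    have := hV.2.1
    refine ⟨_, isLocallyFreeOfRank_quotient_orthogonal hV rfl, ?_⟩
    rw [planeIdeal_eq_rankOneIdeal, orthogonal_orthogonal]

end FixedPoints

/-! ### Isotropic planes and the zero fibre of the moment map -/

section FormQ

variable {A B : Type*} [CommRing A] [CommRing B]

lemma formQ_comm (v w : Fin 6 → A) : formQ A v w = formQ A w v := by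
  rw [formQ_apply, formQ_apply, Matrix.dotProduct_mulVec, dotProduct_comm,
    ← Matrix.mulVec_transpose, matQ_transpose]

lemma formQ_matQ_mulVec (v w : Fin 6 → A) : formQ A v (matQ A *ᵥ w) = v ⬝ᵥ w := by
  rw [formQ_apply, Matrix.mulVec_mulVec, matQ_mul_self, Matrix.one_mulVec]

lemma formQ_matQ_mulVec_matQ_mulVec (v w : Fin 6 → A) :
    formQ A (matQ A *ᵥ v) (matQ A *ᵥ w) = formQ A v w := by
  rw [formQ_matQ_mulVec, dotProduct_comm, ← formQ_apply, formQ_comm]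

lemma map_formQ (f : A →+* B) (v w : Fin 6 → A) :
    f (formQ A v w) = formQ B (f ∘ v) (f ∘ w) := by
  rw [formQ_apply, formQ_apply, RingHom.map_dotProduct, ← matQ_map f]
  exact congrArg _ (_root_.funext fun j => RingHom.map_mulVec f _ _ j)

end FormQ

section Isotropic

variable {A B : Type u} [CommRing A] [CommRing B]

lemma isIsotropic_baseChange (f : A →+* B) {U : Submodule A (Fin 6 → A)} (hU : IsIsotropic U) :
    IsIsotropic (baseChange f U) := by
  have formQ_comp {u v : Fin 6 → A} (hu : u ∈ U) (hv : v ∈ U) : formQ B (f ∘ u) (f ∘ v) = 0 := by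
    rw [← map_formQ, hU u hu v hv, map_zero]
  have formQ_comp_right {u : Fin 6 → A} (hu : u ∈ U) :
      baseChange f U ≤ LinearMap.ker (formQ B (f ∘ u)) := by
    refine Submodule.span_le.2 ?_
    rintro _ ⟨v, hv, rfl⟩
    exact formQ_comp hu hv
  intro x hx y hy
  have : baseChange f U ≤ LinearMap.ker ((formQ B).flip y) := by
    refine Submodule.span_le.2 ?_
    rintro _ ⟨u, hu, rfl⟩
    exact formQ_comp_right hu hy
  exact this hx

lemma matQ_mulVec_mem_baseChange (f : A →+* B) {U : Submodule A (Fin 6 → A)} (hU : U ∈ planes A)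
    {x : Fin 6 → B} (hx : ∀ v ∈ (formQ A).orthogonal U, (f ∘ v) ⬝ᵥ x = 0) :
    matQ B *ᵥ x ∈ baseChange f U := by
  have := hU.2.1
  have := (baseChange_mem_planes f hU).2.1
  have baseChange_orthogonal_le : baseChange f ((formQ A).orthogonal U) ≤
      LinearMap.ker ((formQ B).flip (matQ B *ᵥ x)) := by
    refine Submodule.span_le.2 ?_
    rintro _ ⟨v, hv, rfl⟩
    exact (formQ_matQ_mulVec _ _).trans (hx v hv)
  rw [← orthogonal_orthogonal (baseChange f U), orthogonal_baseChange]
  exact fun w hw => baseChange_orthogonal_le hw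

lemma isIsotropic_of_formQ_self_eq_zero (h2 : IsUnit (2 : A)) {U : Submodule A (Fin 6 → A)}
    (hU : ∀ u ∈ U, formQ A u u = 0) : IsIsotropic U := by
  intro u hu v hv
  have two_mul_formQ := hU (u + v) (U.add_mem hu hv)
  simp only [map_add, LinearMap.add_apply, hU u hu, hU v hv, formQ_comm v u, zero_add, add_zero,
    ← two_mul] at two_mul_formQ
  exact h2.mul_right_eq_zero.1 two_mul_formQ

lemma genMat_mul_matQ_mul_transpose (k l : Fin 2) :
    (genMat A * matQ (CoordRing A) * (genMat A)ᵀ) k l =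
      formQ (CoordRing A) (genMat A k) (genMat A l) := by
  rw [formQ_apply, Matrix.mul_assoc]
  rfl

lemma muIdeal_eq_span_formQ :
    muIdeal = Ideal.span {f | ∃ k l, f = formQ (CoordRing ℂ) (genMat ℂ k) (genMat ℂ l)} := by
  refine le_antisymm (Ideal.span_le.2 ?_) (Ideal.span_le.2 ?_)
  · rintro _ ⟨k, l, rfl⟩
    rw [SetLike.mem_coe, Matrix.mul_apply]
    refine sum_mem fun m _ => Ideal.mul_mem_right _ _ (Ideal.subset_span ⟨k, m, ?_⟩)
    exact genMat_mul_matQ_mul_transpose k m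
  · rintro _ ⟨k, l, rfl⟩
    have matJ_mul_matJ : matJ (CoordRing ℂ) * -matJ (CoordRing ℂ) = 1 := by
      ext i j
      fin_cases i <;> fin_cases j <;> simp [matJ]
    rw [← genMat_mul_matQ_mul_transpose, SetLike.mem_coe, ← Matrix.mul_one (_ * _ * _),
      ← matJ_mul_matJ, ← Matrix.mul_assoc, Matrix.mul_apply]
    exact sum_mem fun m _ => Ideal.mul_mem_right _ _ (Ideal.subset_span ⟨k, m, rfl⟩)

lemma map_muIdeal_le_iff [Algebra ℂ A] {I : Ideal (CoordRing A)} :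
    muIdeal.map (MvPolynomial.map (algebraMap ℂ A)) ≤ I ↔
      ∀ k l, formQ (CoordRing A) (genMat A k) (genMat A l) ∈ I := by
  have map_genMat (k : Fin 2) :
      MvPolynomial.map (algebraMap ℂ A) ∘ genMat ℂ k = genMat A k :=
    _root_.funext fun j => map_X _ _
  have map_formQ_genMat (k l : Fin 2) :
      MvPolynomial.map (algebraMap ℂ A) (formQ (CoordRing ℂ) (genMat ℂ k) (genMat ℂ l)) =
        formQ (CoordRing A) (genMat A k) (genMat A l) := by
    rw [map_formQ, map_genMat, map_genMat]
  rw [muIdeal_eq_span_formQ, Ideal.map_span, Ideal.span_le]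
  constructor
  · intro h k l
    exact h ⟨_, ⟨k, l, rfl⟩, map_formQ_genMat k l⟩
  · rintro h _ ⟨_, ⟨k, l, rfl⟩, rfl⟩
    exact (map_formQ_genMat k l).symm ▸ h k l

lemma isIsotropic_of_formQ_genMat_mem (h2 : IsUnit (2 : A)) {U : Submodule A (Fin 6 → A)}
    {k : Fin 2} (h : formQ (CoordRing A) (genMat A k) (genMat A k) ∈ planeIdeal U) :
    IsIsotropic U := by
  refine isIsotropic_of_formQ_self_eq_zero h2 fun u hu => ?_
  have rename_X_comp : (rename (Prod.mk k) : MvPolynomial (Fin 6) A →ₐ[A] _).toRingHom ∘ X =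
      genMat A k :=
    _root_.funext fun j => rename_X _ _
  have formQ_X_mem : formQ (MvPolynomial (Fin 6) A) X X ∈ formIdeal ((formQ A).orthogonal U) := by
    rw [← rowIdeal_rankOneIdeal _ k, ← planeIdeal_eq_rankOneIdeal, rowIdeal, Ideal.mem_comap,
      ← AlgHom.coe_toRingHom, map_formQ]
    exact rename_X_comp.symm ▸ h
  let evalQu : MvPolynomial (Fin 6) A →+* A := eval (matQ A *ᵥ u)
  have formIdeal_le_ker : formIdeal ((formQ A).orthogonal U) ≤ RingHom.ker evalQu := by
    refine Ideal.span_le.2 ?_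
    rintro _ ⟨v, hv, rfl⟩
    have : formQ A v u = 0 := (formQ_comm v u).trans (hv u hu)
    rw [formQ_apply] at this
    simpa [evalQu, linForm_apply, dotProduct, smul_eq_C_mul] using this
  have formQ_matQ_mulVec_eq_zero : evalQu (formQ (MvPolynomial (Fin 6) A) X X) = 0 :=
    formIdeal_le_ker formQ_X_mem
  have evalQu_comp_X : evalQu ∘ X = matQ A *ᵥ u := _root_.funext fun j => eval_X j
  rwa [map_formQ, evalQu_comp_X, formQ_matQ_mulVec_matQ_mulVec] at formQ_matQ_mulVec_eq_zero

/-- Modulo `planeIdeal U` the rows of the generic matrix vanish on the orthogonal complement of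
`U`, so that `Q` maps them into `U` and their pairings vanish. -/
lemma formQ_genMat_mem_planeIdeal {U : Submodule A (Fin 6 → A)} (hU : U ∈ isoPlanes A)
    (k l : Fin 2) :
    formQ (CoordRing A) (genMat A k) (genMat A l) ∈ planeIdeal U := by
  let q := Ideal.Quotient.mk (planeIdeal U)
  let c : A →+* CoordRing A ⧸ planeIdeal U := q.comp C
  have dotProduct_row {v : Fin 6 → A} (hv : v ∈ (formQ A).orthogonal U) (k : Fin 2) :
      (c ∘ v) ⬝ᵥ (q ∘ genMat A k) = 0 := by
    have : q ((genMat A *ᵥ fun j => C (v j)) k) = 0 :=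
      Ideal.Quotient.eq_zero_iff_mem.2 (Ideal.mem_sup_left (Ideal.subset_span ⟨v, hv, k, rfl⟩))
    rw [dotProduct_comm, ← this, Matrix.mulVec, RingHom.map_dotProduct]
    rfl
  have row_mem (k : Fin 2) : matQ _ *ᵥ (q ∘ genMat A k) ∈ baseChange c U :=
    matQ_mulVec_mem_baseChange c hU.1 fun v hv => dotProduct_row hv k
  rw [← Ideal.Quotient.eq_zero_iff_mem, map_formQ, ← formQ_matQ_mulVec_matQ_mulVec]
  exact isIsotropic_baseChange c hU.2 _ (row_mem k) _ (row_mem l)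

end Isotropic

section ZeroFibre

variable {A : Type u} [CommRing A] [Algebra ℂ A]

lemma mem_slHilbFixed_iff {K : Ideal (CoordRing ℂ)} {I : Ideal (CoordRing A)} :
    I ∈ slHilbFixed K A ↔
      I ∈ slHilbFixed ⊥ A ∧ K.map (MvPolynomial.map (algebraMap ℂ A)) ≤ I := by
  constructor
  · rintro ⟨⟨hK, hI⟩, ht⟩
    exact ⟨⟨⟨Ideal.map_bot.trans_le bot_le, hI⟩, ht⟩, hK⟩
  · rintro ⟨⟨⟨-, hI⟩, ht⟩, hK⟩
    exact ⟨⟨hK, hI⟩, ht⟩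

lemma planeIdeal_mem_slHilbFixed_muIdeal_iff {U : Submodule A (Fin 6 → A)} (hU : U ∈ planes A) :
    planeIdeal U ∈ slHilbFixed muIdeal A ↔ IsIsotropic U := by
  have isUnit_two : IsUnit (2 : A) := by
    simpa only [map_ofNat] using (IsUnit.mk0 (2 : ℂ) two_ne_zero).map (algebraMap ℂ A)
  rw [mem_slHilbFixed_iff, map_muIdeal_le_iff]
  exact ⟨fun h => isIsotropic_of_formQ_genMat_mem isUnit_two (h.2 0 0),
    fun h => ⟨(bijOn_planeIdeal A).mapsTo hU, formQ_genMat_mem_planeIdeal ⟨hU, h⟩⟩⟩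

lemma bijOn_planeIdeal_isoPlanes (A : Type u) [CommRing A] [Algebra ℂ A] :
    Set.BijOn planeIdeal (isoPlanes A) (slHilbFixed muIdeal A) := by
  refine ⟨fun U hU => (planeIdeal_mem_slHilbFixed_muIdeal_iff hU.1).2 hU.2,
    (bijOn_planeIdeal A).injOn.mono fun U hU => hU.1, fun I hI => ?_⟩
  obtain ⟨U, hU, rfl⟩ := (bijOn_planeIdeal A).surjOn (mem_slHilbFixed_iff.1 hI).1
  exact ⟨U, ⟨hU, (planeIdeal_mem_slHilbFixed_muIdeal_iff hU).1 hI⟩, rfl⟩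

end ZeroFibre

section BaseChange

variable {A B : Type u} [CommRing A] [CommRing B] (f : A →+* B)

lemma rankOneIdeal_baseChange (V : Submodule A (Fin 6 → A)) :
    rankOneIdeal (Fin 2) (baseChange f V) =
      (rankOneIdeal (Fin 2) V).map (MvPolynomial.map f) := by
  have map_row (v : Fin 6 → A) (k : Fin 2) :
      MvPolynomial.map f (rename (Prod.mk k) (linForm v)) =
        rename (Prod.mk k) (linForm (f ∘ v)) := by
    rw [map_rename, map_linForm]
    rfl
  have map_minor (i j : Fin 6) : MvPolynomial.map f (minor A i j) = minor B i j := by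
    simp only [minor_eq, map_sub, map_mul, map_X]
  refine le_antisymm (rankOneIdeal_le_iff.2 ⟨fun k => ?_, ?_⟩)
    (Ideal.map_le_iff_le_comap.2 (rankOneIdeal_le_iff.2 ⟨fun k v hv => ?_, ?_⟩))
  · let J := ((rankOneIdeal (Fin 2) V).map (MvPolynomial.map f)).restrictScalars B
    have : baseChange f V ≤ J.comap ((rename (Prod.mk k)).toLinearMap.comp linForm) := by
      refine Submodule.span_le.2 ?_
      rintro _ ⟨v, hv, rfl⟩
      exact (map_row v k).subst (motive := (· ∈ J))
        (Ideal.mem_map_of_mem _ (rename_linForm_mem_rankOneIdeal hv k))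
    exact this
  · rw [minorIdeal_eq_span_minor, Ideal.span_le]
    rintro _ ⟨i, j, rfl⟩
    refine map_minor i j ▸ Ideal.mem_map_of_mem _ (Ideal.mem_sup_right ?_)
    exact minor_mem_minorIdeal A i j
  · have comp_mem : f ∘ v ∈ baseChange f V := Submodule.subset_span ⟨v, hv, rfl⟩
    rw [Ideal.mem_comap]
    exact (map_row v k).symm.subst (motive := (· ∈ rankOneIdeal (Fin 2) (baseChange f V)))
      (rename_linForm_mem_rankOneIdeal comp_mem k)
  · rw [minorIdeal_eq_span_minor, Ideal.span_le]
    rintro _ ⟨i, j, rfl⟩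
    refine Ideal.mem_comap.2 (map_minor i j ▸ Ideal.mem_sup_right ?_)
    exact minor_mem_minorIdeal B i j

lemma planeIdeal_baseChange (U : Submodule A (Fin 6 → A))
    [Module.Projective A ((Fin 6 → A) ⧸ U)] :
    planeIdeal (baseChange f U) = (planeIdeal U).map (MvPolynomial.map f) := by
  rw [planeIdeal_eq_rankOneIdeal, planeIdeal_eq_rankOneIdeal, orthogonal_baseChange,
    rankOneIdeal_baseChange]

end BaseChange

/-! ### Closed points -/

lemma mul_sub_mul_eq_zero_of_sup_span_pair_eq_top {A M S : Type*} [CommRing A] [AddCommGroup M]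
    [Module A M] [CommRing S] [Algebra A S] {φ ψ : M →ₗ[A] S} {V : Submodule A M}
    (hφ : V ≤ LinearMap.ker φ) (hψ : V ≤ LinearMap.ker ψ) {x y : M}
    (h : V ⊔ Submodule.span A {x, y} = ⊤) (hxy : φ x * ψ y - φ y * ψ x = 0) (v w : M) :
    φ v * ψ w - φ w * ψ v = 0 := by
  have exists_eq (v : M) : ∃ a b : A, φ v = a • φ x + b • φ y ∧ ψ v = a • ψ x + b • ψ y := by
    obtain ⟨u, hu, z, hz, rfl⟩ := Submodule.mem_sup.1 (h.symm ▸ Submodule.mem_top : v ∈ V ⊔ _)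
    obtain ⟨a, b, rfl⟩ := Submodule.mem_span_pair.1 hz
    refine ⟨a, b, ?_, ?_⟩
    · rw [map_add, LinearMap.mem_ker.1 (hφ hu), zero_add, map_add, map_smul, map_smul]
    · rw [map_add, LinearMap.mem_ker.1 (hψ hu), zero_add, map_add, map_smul, map_smul]
  obtain ⟨a, b, hφv, hψv⟩ := exists_eq v
  obtain ⟨c, d, hφw, hψw⟩ := exists_eq w
  calc φ v * ψ w - φ w * ψ v
    _ = (a * d - b * c) • (φ x * ψ y - φ y * ψ x) := by
      rw [hφv, hψv, hφw, hψw]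
      simp only [Algebra.smul_def, map_sub, map_mul]
      ring
    _ = 0 := by rw [hxy, smul_zero]

lemma linIdeal_sup_span_minor {A : Type u} [CommRing A] {V : Submodule A (Fin 6 → A)}
    {i j : Fin 6} (h : V ⊔ Submodule.span A {Pi.single i 1, Pi.single j 1} = ⊤) :
    linIdeal V ⊔ Ideal.span {minor A i j} = rankOneIdeal (Fin 2) V := by
  rw [← linIdeal_sup_minorIdeal, minorIdeal_eq_span_minor]
  refine le_antisymm (sup_le_sup_left (Ideal.span_mono ?_) _)
    (sup_le le_sup_left (Ideal.span_le.2 ?_))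
  · rintro _ rfl
    exact ⟨i, j, rfl⟩
  rintro _ ⟨m, n, rfl⟩
  set K := linIdeal V ⊔ Ideal.span {minor A i j}
  let row (k : Fin 2) : (Fin 6 → A) →ₗ[A] CoordRing A ⧸ K :=
    (Ideal.Quotient.mkₐ A K).toLinearMap.comp ((rename (Prod.mk k)).toLinearMap.comp linForm)
  have mk_minor (m n : Fin 6) : Ideal.Quotient.mk K (minor A m n) =
      row 0 (Pi.single m 1) * row 1 (Pi.single n 1) -
        row 0 (Pi.single n 1) * row 1 (Pi.single m 1) := by
    simp [row, minor_eq]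
  have le_ker_row (k : Fin 2) : V ≤ LinearMap.ker (row k) := fun v hv =>
    Ideal.Quotient.eq_zero_iff_mem.2
      (Ideal.mem_sup_left (Ideal.subset_span ⟨v, hv, k, (genMat_mulVec_C v k).symm⟩))
  have mk_minor_eq_zero : Ideal.Quotient.mk K (minor A i j) = 0 :=
    Ideal.Quotient.eq_zero_iff_mem.2 (Ideal.mem_sup_right (Ideal.subset_span rfl))
  rw [SetLike.mem_coe, ← Ideal.Quotient.eq_zero_iff_mem, mk_minor]
  exact mul_sub_mul_eq_zero_of_sup_span_pair_eq_top (le_ker_row 0) (le_ker_row 1) h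
    (mk_minor i j ▸ mk_minor_eq_zero) _ _

section Field

lemma exists_sup_span_single_eq_top {K ι : Type*} [Field K] [Finite ι] [DecidableEq ι]
    {V : Submodule K (ι → K)} {n : ℕ} (hn : Module.finrank K ((ι → K) ⧸ V) = n) :
    ∃ c : Fin n → ι, V ⊔ Submodule.span K (Set.range fun m => Pi.single (c m) 1) = ⊤ := by
  subst hn
  have span_mkQ_single :
      Submodule.span K (Set.range fun i => V.mkQ (Pi.single i 1)) = ⊤ := by
    rw [← Submodule.range_mkQ V, ← Submodule.map_top, ← (Pi.basisFun K ι).span_eq,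
      Submodule.map_span, ← Set.range_comp]
    congr 2
    ext1 i
    rw [Function.comp_apply, Pi.basisFun_apply]
  have := Submodule.exists_fun_fin_finrank_span_eq K (Set.range fun i => V.mkQ (Pi.single i 1))
  rw [span_mkQ_single, finrank_top] at this
  obtain ⟨b, hb, span_b, -⟩ := this
  choose c hc using hb
  refine ⟨c, ?_⟩
  rw [← Submodule.map_mkQ_eq_top, Submodule.map_span, ← Set.range_comp, ← span_b]
  exact congrArg (fun g => Submodule.span K (Set.range g)) (_root_.funext hc)

variable {K : Type u} [Field K]

lemma isLocallyFreeOfRank_iff_finrank {M : Type u} [AddCommGroup M] [Module K M]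
    [Module.Finite K M] {n : ℕ} : IsLocallyFreeOfRank K M n ↔ Module.finrank K M = n := by
  rw [IsLocallyFreeOfRank, Module.rankAtStalk_eq_finrank_of_free]
  exact ⟨fun h => h.2.2 ⊥, fun h => ⟨inferInstance, inferInstance, fun _ => h⟩⟩

lemma isLocallyFreeOfRank_quotient_iff_finrank {V : Submodule K (Fin 6 → K)} {m n : ℕ}
    (hmn : m + n = 6) :
    IsLocallyFreeOfRank K ((Fin 6 → K) ⧸ V) m ↔ Module.finrank K V = n := by
  have := V.finrank_quotient_add_finrank
  rw [Module.finrank_fin_fun] at this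
  rw [isLocallyFreeOfRank_iff_finrank]
  omega

variable [Algebra ℂ K] {I : Ideal (CoordRing K)}

lemma mem_slHilbFixed_bot_iff_exists_minor :
    I ∈ slHilbFixed ⊥ K ↔ ∃ V : Submodule K (Fin 6 → K), Module.finrank K V = 4 ∧
      ∃ i j : Fin 6, V ⊔ Submodule.span K {Pi.single i 1, Pi.single j 1} = ⊤ ∧
        I = linIdeal V ⊔ Ideal.span {minor K i j} := by
  rw [mem_slHilbFixed_bot_iff_exists]
  constructor
  · rintro ⟨V, hV, rfl⟩
    obtain ⟨c, hc⟩ := exists_sup_span_single_eq_top (isLocallyFreeOfRank_iff_finrank.1 hV)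
    have range_eq : (Set.range fun m => Pi.single (M := fun _ : Fin 6 => K) (c m) 1) =
        {Pi.single (c 0) 1, Pi.single (c 1) 1} :=
      Set.ext fun v => by simp [Fin.exists_fin_two, eq_comm]
    rw [range_eq] at hc
    exact ⟨V, (isLocallyFreeOfRank_quotient_iff_finrank rfl).1 hV, c 0, c 1, hc,
      (linIdeal_sup_span_minor hc).symm⟩
  · rintro ⟨V, hV, i, j, hij, rfl⟩
    exact ⟨V, (isLocallyFreeOfRank_quotient_iff_finrank rfl).2 hV,
      (linIdeal_sup_span_minor hij).symm⟩

lemma mem_slHilbFixed_muIdeal_iff_exists_minor :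
    I ∈ slHilbFixed muIdeal K ↔ ∃ V : Submodule K (Fin 6 → K), Module.finrank K V = 4 ∧
      IsIsotropic ((formQ K).orthogonal V) ∧
      ∃ i j : Fin 6, V ⊔ Submodule.span K {Pi.single i 1, Pi.single j 1} = ⊤ ∧
        I = linIdeal V ⊔ Ideal.span {minor K i j} := by
  have mem_iff {V : Submodule K (Fin 6 → K)} (hV : Module.finrank K V = 4) {i j : Fin 6}
      (hij : V ⊔ Submodule.span K {Pi.single i 1, Pi.single j 1} = ⊤) :
      linIdeal V ⊔ Ideal.span {minor K i j} ∈ slHilbFixed muIdeal K ↔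
        IsIsotropic ((formQ K).orthogonal V) := by
    have orthogonal_mem_planes : (formQ K).orthogonal V ∈ planes K :=
      isLocallyFreeOfRank_quotient_orthogonal
        ((isLocallyFreeOfRank_quotient_iff_finrank (m := 2) rfl).2 hV) rfl
    rw [← planeIdeal_mem_slHilbFixed_muIdeal_iff orthogonal_mem_planes,
      planeIdeal_eq_rankOneIdeal, orthogonal_orthogonal, linIdeal_sup_span_minor hij]
  constructor
  · intro hI
    obtain ⟨V, hV, i, j, hij, rfl⟩ :=
      mem_slHilbFixed_bot_iff_exists_minor.1 (mem_slHilbFixed_iff.1 hI).1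
    exact ⟨V, hV, (mem_iff hV hij).1 hI, i, j, hij, rfl⟩
  · rintro ⟨V, hV, hiso, i, j, hij, rfl⟩
    exact (mem_iff hV hij).2 hiso

end Field

end SlTwoHilb

open SlTwoHilb in
theorem mainTheorem5_general :
    (∀ (A : Type u) [CommRing A] [Algebra ℂ A],
      Set.BijOn planeIdeal (planes A) (slHilbFixed ⊥ A) ∧
      Set.BijOn planeIdeal (isoPlanes A) (slHilbFixed muIdeal A)) ∧
    (∀ (A B : Type u) [CommRing A] [CommRing B] (f : A →+* B), ∀ U ∈ planes A,
      baseChange f U ∈ planes B ∧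
      (IsIsotropic U → IsIsotropic (baseChange f U)) ∧
      planeIdeal (baseChange f U) = (planeIdeal U).map (MvPolynomial.map f)) ∧
    (∀ (K : Type v) [Field K] [Algebra ℂ K],
      Set.BijOn planeIdeal {U : Submodule K (Fin 6 → K) | Module.finrank K U = 2}
        (slHilbFixed ⊥ K) ∧
      Set.BijOn planeIdeal {U : Submodule K (Fin 6 → K) | Module.finrank K U = 2 ∧ IsIsotropic U}
        (slHilbFixed muIdeal K) ∧
      (∀ I : Ideal (CoordRing K), I ∈ slHilbFixed ⊥ K ↔
        ∃ V : Submodule K (Fin 6 → K), Module.finrank K V = 4 ∧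
          ∃ i j : Fin 6, V ⊔ Submodule.span K {Pi.single i 1, Pi.single j 1} = ⊤ ∧
            I = linIdeal V ⊔ Ideal.span {minor K i j}) ∧
      (∀ I : Ideal (CoordRing K), I ∈ slHilbFixed muIdeal K ↔
        ∃ V : Submodule K (Fin 6 → K), Module.finrank K V = 4 ∧
          IsIsotropic ((formQ K).orthogonal V) ∧
          ∃ i j : Fin 6, V ⊔ Submodule.span K {Pi.single i 1, Pi.single j 1} = ⊤ ∧
            I = linIdeal V ⊔ Ideal.span {minor K i j})) := by
  refine ⟨fun A _ _ => ⟨bijOn_planeIdeal A, bijOn_planeIdeal_isoPlanes A⟩,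
    fun A B _ _ f U hU => ?_, fun K _ _ => ?_⟩
  · have := hU.2.1
    exact ⟨baseChange_mem_planes f hU, isIsotropic_baseChange f, planeIdeal_baseChange f U⟩
  · have mem_planes_iff (U : Submodule K (Fin 6 → K)) :
        Module.finrank K U = 2 ↔ U ∈ planes K :=
      (isLocallyFreeOfRank_quotient_iff_finrank rfl).symm
    simp only [mem_planes_iff]
    exact ⟨bijOn_planeIdeal K, bijOn_planeIdeal_isoPlanes K,
      fun _ => mem_slHilbFixed_bot_iff_exists_minor,
      fun _ => mem_slHilbFixed_muIdeal_iff_exists_minor⟩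

open SlTwoHilb in
theorem mainTheorem5 :
    (∀ (A : Type u) [CommRing A] [Algebra ℂ A],
      Set.BijOn planeIdeal (planes A) (slHilbFixed ⊥ A) ∧
      Set.BijOn planeIdeal (isoPlanes A) (slHilbFixed muIdeal A)) ∧
    (∀ (A B : Type u) [CommRing A] [CommRing B] [Algebra ℂ A] [Algebra ℂ B] (f : A →ₐ[ℂ] B),
      ∀ U ∈ planes A,
        baseChange (f : A →+* B) U ∈ planes B ∧
        (IsIsotropic U → IsIsotropic (baseChange (f : A →+* B) U)) ∧
        planeIdeal (baseChange (f : A →+* B) U) =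
          (planeIdeal U).map (MvPolynomial.map (f : A →+* B))) ∧
    Set.BijOn planeIdeal {U : Submodule ℂ (Fin 6 → ℂ) | Module.finrank ℂ U = 2}
      (slHilbFixed ⊥ ℂ) ∧
    Set.BijOn planeIdeal {U : Submodule ℂ (Fin 6 → ℂ) | Module.finrank ℂ U = 2 ∧ IsIsotropic U}
      (slHilbFixed muIdeal ℂ) ∧
    (∀ I : Ideal (CoordRing ℂ), I ∈ slHilbFixed ⊥ ℂ ↔
      ∃ V : Submodule ℂ (Fin 6 → ℂ), Module.finrank ℂ V = 4 ∧
        ∃ i j : Fin 6, V ⊔ Submodule.span ℂ {Pi.single i 1, Pi.single j 1} = ⊤ ∧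
          I = linIdeal V ⊔ Ideal.span {minor ℂ i j}) ∧
    (∀ I : Ideal (CoordRing ℂ), I ∈ slHilbFixed muIdeal ℂ ↔
      ∃ V : Submodule ℂ (Fin 6 → ℂ), Module.finrank ℂ V = 4 ∧
        IsIsotropic ((formQ ℂ).orthogonal V) ∧
        ∃ i j : Fin 6, V ⊔ Submodule.span ℂ {Pi.single i 1, Pi.single j 1} = ⊤ ∧
          I = linIdeal V ⊔ Ideal.span {minor ℂ i j}) := by
  obtain ⟨bijOn, baseChange, closedPoints⟩ := mainTheorem5_general.{u, 0}
  exact ⟨bijOn, fun A B _ _ _ _ f U hU => baseChange A B f U hU, closedPoints ℂ⟩
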